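/- Let $k$ be a field of characteristic $p>0$ and $k[\boldsymbol{x}]=k[x_1,x_2,x_3]$ the polynomial ring in three variables over $k$. Let $l,m\ge 1$ and $t\ge 2$ be integers with $mt\ge 3$. Put $$f=x_1x_3-x_2^t,\qquad r=f^lx_2+x_1^m,\qquad g=x_1^{-1}\bigl(f^{lt+1}+r^t\bigr)\in k[\boldsymbol{x}],\qquad C=k[f^{\pm1},g^{\pm1}]\subset k(\boldsymbol{x}).$$ Then $f,g,r$ are algebraically independent over $k$, $k[\boldsymbol{x}]\subset C[r]$, and the homomorphism $\widetilde\epsilon: C[r]\to C[r][T]$, $u(r)\mapsto u(r+f^lgT)$, of $C$-algebras maps $k[\boldsymbol{x}]$ into $k[\boldsymbol{x}][T]$. Let $\epsilon: k[\boldsymbol{x}]\to k[\boldsymbol{x}][T]$ be its restriction (a $\mathbf{G}_a$-action). Put $k[\boldsymbol{x}]^{\epsilon}=\{a\mid \epsilon(a)=a\}$, and for $h\in k[\boldsymbol{x}]^{\epsilon}$ let $\epsilon_h: k[\boldsymbol{x}]\to k[\boldsymbol{x}]$, $b\mapsto\epsilon(b)|_{T=h}$, with invariant ring $k[\boldsymbol{x}]^{\epsilon_h}=\{b\mid\epsilon_h(b)=b\}$.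 Let $q=r^p-(f^lgh)^{p-1}r$, and let $\psi: C[r^p]\to C[q]$, $u(r^p)\mapsto u(q)$, be the substitution homomorphism of $C$-algebras; note that $x_1^p,x_2^p,x_3^p\in C[r^p]$. Theorem. Let $h\in k[\boldsymbol{x}]^{\epsilon}$. Assume that $p\nmid t$, $p\nmid mt-1$ and $h^{p-1}\in f^{l+1}g^2k[f,g]\setminus\{0\}$. (i) We have $k[\boldsymbol{x}]^{\epsilon_h}=\psi\bigl(k[x_1^p,x_2^p,x_3^p,f,g]\bigr)=k[\psi(x_1^p),\psi(x_2^p),\psi(x_3^p),f,g]$. (ii) The $k$-algebra $k[\boldsymbol{x}]^{\epsilon_h}$ is isomorphic to $k[x_1,x_2,x_3,y,z]/(y^p-f,\,z^p-g)$, where $k[x_1,x_2,x_3,y,z]$ is the polynomial ring in five variables over $k$, and it is not isomorphic to $k[x_1,x_2,x_3]$ as a $k$-algebra. -/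

import Mathlib

namespace RankThree

/-- Integers `l, m ≥ 1` and `t ≥ 2` with `m * t ≥ 3`. -/
structure Params where
  l : ℕ
  m : ℕ
  t : ℕ
  one_le_l : 1 ≤ l
  one_le_m : 1 ≤ m
  two_le_t : 2 ≤ t
  three_le_mt : 3 ≤ m * t

/-- If `s` is transcendental over `A` and `S = A[s]`, this is the substitution
`A[s] → B`, `u(s) ↦ u(b)`, as a homomorphism of `A`-algebras. -/
noncomputable def subst {A K B : Type*} [CommRing A] [CommRing K] [Algebra A K]
    [Semiring B] [Algebra A B] {s : K} (hs : Transcendental A s) (S : Subalgebra A K)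
    (hS : S = Algebra.adjoin A {s}) (b : B) : S →ₐ[A] B :=
  ((Polynomial.aeval b).comp
    (Polynomial.algEquivOfTranscendental A s hs).symm.toAlgHom).comp
      (Subalgebra.equivOfEq S _ hS).toAlgHom

theorem subst_gen {A K B : Type*} [CommRing A] [CommRing K] [Algebra A K]
    [Semiring B] [Algebra A B] {s : K} (hs : Transcendental A s) (S : Subalgebra A K)
    (hS : S = Algebra.adjoin A {s}) (b : B) (h : s ∈ S) : subst hs S hS b ⟨s, h⟩ = b := by
  subst hS
  have : (Polynomial.algEquivOfTranscendental A s hs).symm ⟨s, h⟩ = Polynomial.X := by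
    rw [AlgEquiv.symm_apply_eq]
    ext
    simp
  simp [subst, this]

variable (k : Type*) [Field k] (D : Params)

/-- The polynomial ring `k[x₁, x₂, x₃]`; the variable `xᵢ₊₁` is `X i` for `i : Fin 3`. -/
abbrev Poly := MvPolynomial (Fin 3) k

/-- The field of rational functions `k(x₁, x₂, x₃)`. -/
abbrev Frac := FractionRing (Poly k)

open MvPolynomial in
/-- `f = x₁ x₃ - x₂ ^ t`. -/
noncomputable def f : Poly k := X 0 * X 2 - X 1 ^ D.t

open MvPolynomial in
/-- `r = f ^ l * x₂ + x₁ ^ m`. -/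
noncomputable def r : Poly k := f k D ^ D.l * X 1 + X 0 ^ D.m

open MvPolynomial in
/-- The polynomial `g = x₁⁻¹ (f ^ (l t + 1) + r ^ t)`, see `X_mul_g`. It is written here without
division, using
`r ^ t - (f ^ l x₂) ^ t = x₁ ^ m * ∑_{i < t} r ^ i (f ^ l x₂) ^ (t - 1 - i)`. -/
noncomputable def g : Poly k :=
  f k D ^ (D.l * D.t) * X 2 +
    X 0 ^ (D.m - 1) *
      ∑ i ∈ Finset.range D.t, r k D ^ i * (f k D ^ D.l * X 1) ^ (D.t - 1 - i)

open MvPolynomial in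
/-- This identity characterizes `g`. -/
theorem X_mul_g : X 0 * g k D = f k D ^ (D.l * D.t + 1) + r k D ^ D.t := by
  have h1 := (Commute.all (r k D) (f k D ^ D.l * X 1)).geom_sum₂_mul D.t
  have h2 : r k D - f k D ^ D.l * X 1 = X 0 * X 0 ^ (D.m - 1) := by
    rw [← pow_succ', Nat.sub_add_cancel D.one_le_m, r]; ring
  rw [h2] at h1
  have h3 : X 0 * X 2 = f k D + X 1 ^ D.t := by rw [f]; ring
  rw [g]
  linear_combination h1 + f k D ^ (D.l * D.t) * h3

theorem f_ne_zero : f k D ≠ 0 := by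
  intro h
  have := congrArg (MvPolynomial.eval ![1, 0, 1]) h
  have ht : D.t ≠ 0 := by have := D.two_le_t; omega
  simp [f, ht] at this

theorem g_ne_zero : g k D ≠ 0 := by
  intro h
  have := congrArg (MvPolynomial.eval ![1, 0, 0]) h
  have ht : D.t ≠ 0 := by have := D.two_le_t; omega
  have hl : D.l ≠ 0 := by have := D.one_le_l; omega
  rw [g] at this
  simp only [f, r, map_add, map_mul, map_pow, map_sub, map_sum, MvPolynomial.eval_X] at this
  simp [ht, hl] at this
  rw [Finset.sum_eq_single (D.t - 1)] at this
  · simp at this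
  · intro i hi hne
    rw [zero_pow]
    have := Finset.mem_range.1 hi
    omega
  · intro h0
    exact absurd (Finset.mem_range.2 (by omega)) h0

noncomputable instance : Field (Frac k) := inferInstance
noncomputable instance : CommRing (Frac k) := inferInstance
noncomputable instance : Algebra k (Frac k) := inferInstance

/-- The inclusion `k[x₁, x₂, x₃] ⊆ k(x₁, x₂, x₃)`. -/
noncomputable def toFrac : Poly k →ₐ[k] Frac k := IsScalarTower.toAlgHom k (Poly k) (Frac k)

theorem toFrac_injective : Function.Injective (toFrac k) :=
  IsFractionRing.injective (Poly k) (Frac k)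

/-- `C = k[f, f⁻¹, g, g⁻¹]`, as a subring of `k(x₁, x₂, x₃)`. -/
noncomputable def C : Subalgebra k (Frac k) :=
  Algebra.adjoin k {toFrac k (f k D), (toFrac k (f k D))⁻¹,
    toFrac k (g k D), (toFrac k (g k D))⁻¹}

noncomputable instance : CommRing (C k D) := (C k D).toCommRing
noncomputable instance : IsDomain (C k D) := inferInstance
noncomputable instance : Algebra k (C k D) := (C k D).algebra
noncomputable instance : Algebra (C k D) (Frac k) := (C k D).toAlgebra
instance : IsScalarTower k (C k D) (Frac k) := inferInstance

theorem f_mem_C : toFrac k (f k D) ∈ C k D := Algebra.subset_adjoin (by simp)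
theorem f_inv_mem_C : (toFrac k (f k D))⁻¹ ∈ C k D := Algebra.subset_adjoin (by simp)
theorem g_mem_C : toFrac k (g k D) ∈ C k D := Algebra.subset_adjoin (by simp)
theorem g_inv_mem_C : (toFrac k (g k D))⁻¹ ∈ C k D := Algebra.subset_adjoin (by simp)

theorem tf_ne_zero : toFrac k (f k D) ≠ 0 :=
  (map_ne_zero_iff _ (toFrac_injective k)).2 (f_ne_zero k D)

theorem tg_ne_zero : toFrac k (g k D) ≠ 0 :=
  (map_ne_zero_iff _ (toFrac_injective k)).2 (g_ne_zero k D)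

/-- `x₁ = g⁻¹ (f ^ (l t + 1) + r ^ t)`. -/
theorem x0_eq : toFrac k (MvPolynomial.X 0) = (toFrac k (g k D))⁻¹ *
    (toFrac k (f k D) ^ (D.l * D.t + 1) + toFrac k (r k D) ^ D.t) := by
  rw [eq_inv_mul_iff_mul_eq₀ (tg_ne_zero k D)]
  rw [← map_pow, ← map_pow, ← map_add, ← X_mul_g, map_mul, mul_comm]

/-- `x₂ = f ^ (-l) (r - x₁ ^ m)`. -/
theorem x1_eq : toFrac k (MvPolynomial.X 1) = (toFrac k (f k D))⁻¹ ^ D.l *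
    (toFrac k (r k D) - toFrac k (MvPolynomial.X 0) ^ D.m) := by
  rw [inv_pow, eq_inv_mul_iff_mul_eq₀ (pow_ne_zero _ (tf_ne_zero k D))]
  simp [r]

/-- `x₃ = f ^ (-l t) (g - ⋯)`. -/
theorem x2_eq : toFrac k (MvPolynomial.X 2) = (toFrac k (f k D))⁻¹ ^ (D.l * D.t) *
    (toFrac k (g k D) - toFrac k (MvPolynomial.X 0) ^ (D.m - 1) *
      ∑ i ∈ Finset.range D.t, toFrac k (r k D) ^ i *
        (toFrac k (f k D) ^ D.l * toFrac k (MvPolynomial.X 1)) ^ (D.t - 1 - i)) := by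
  rw [inv_pow, eq_inv_mul_iff_mul_eq₀ (pow_ne_zero _ (tf_ne_zero k D))]
  rw [g]
  simp

/-- `f, g, r` are algebraically independent over `k`. -/
theorem algebraicIndependent_fgr :
    AlgebraicIndependent k ![toFrac k (f k D), toFrac k (g k D), toFrac k (r k D)] := by
  set v : Fin 3 → Frac k := ![toFrac k (f k D), toFrac k (g k D), toFrac k (r k D)] with hv
  have hgen : ∀ i, IsAlgebraic (Algebra.adjoin k (Set.range v)) (v i) := fun i =>
    isAlgebraic_algebraMap (⟨v i, Algebra.subset_adjoin ⟨i, rfl⟩⟩ :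
      Algebra.adjoin k (Set.range v))
  have hF : IsAlgebraic (Algebra.adjoin k (Set.range v)) (toFrac k (f k D)) := hgen 0
  have hG : IsAlgebraic (Algebra.adjoin k (Set.range v)) (toFrac k (g k D)) := hgen 1
  have hR : IsAlgebraic (Algebra.adjoin k (Set.range v)) (toFrac k (r k D)) := hgen 2
  have h0 : IsAlgebraic (Algebra.adjoin k (Set.range v)) (toFrac k (MvPolynomial.X 0)) := by
    rw [x0_eq k D]
    exact hG.inv.mul ((hF.pow _).add (hR.pow _))
  have h1 : IsAlgebraic (Algebra.adjoin k (Set.range v)) (toFrac k (MvPolynomial.X 1)) := by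
    rw [x1_eq k D]
    exact (hF.inv.pow _).mul (hR.sub (h0.pow _))
  have h2 : IsAlgebraic (Algebra.adjoin k (Set.range v)) (toFrac k (MvPolynomial.X 2)) := by
    rw [x2_eq k D]
    refine (hF.inv.pow _).mul (hG.sub ((h0.pow _).mul ?_))
    refine Finset.sum_induction _ (IsAlgebraic (Algebra.adjoin k (Set.range v)))
      (fun _ _ ha hb => ha.add hb) isAlgebraic_zero fun i _ => ?_
    exact (hR.pow _).mul (((hF.pow _).mul h1).pow _)
  have hp : ∀ a : Poly k, IsAlgebraic (Algebra.adjoin k (Set.range v)) (toFrac k a) := by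
    intro a
    induction a using MvPolynomial.induction_on with
    | C c =>
      have : toFrac k (MvPolynomial.C c) =
          algebraMap (Algebra.adjoin k (Set.range v)) (Frac k)
            (algebraMap k (Algebra.adjoin k (Set.range v)) c) := by
        rw [← IsScalarTower.algebraMap_apply]
        exact (toFrac k).commutes c
      rw [this]
      exact isAlgebraic_algebraMap _
    | add a b ha hb => rw [map_add]; exact ha.add hb
    | mul_X a i ha =>
      rw [map_mul]
      refine ha.mul ?_
      fin_cases i
      · exact h0
      · exact h1
      · exact h2
  have halg : Algebra.IsAlgebraic (Algebra.adjoin k (Set.range v)) (Frac k) := by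
    refine ⟨fun x => ?_⟩
    obtain ⟨a, b, -, rfl⟩ := IsFractionRing.div_surjective (A := Poly k) x
    rw [div_eq_mul_inv]
    exact (hp a).mul (hp b).inv
  refine (Algebra.IsAlgebraic.isTranscendenceBasis_of_lift_le_trdeg_of_finite k v ?_).1
  have hX : AlgebraicIndependent k (fun i : Fin 3 => toFrac k (MvPolynomial.X i)) := by
    have := (MvPolynomial.algebraicIndependent_X (Fin 3) k).map'
      (f := toFrac k) (toFrac_injective k)
    exact this
  exact hX.lift_cardinalMk_le_trdeg

theorem transcendental_of_forall_isAlgebraic {k K : Type*} [Field k] [Field K] [Algebra k K]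
    (A E : Subalgebra k K) (hE : ∀ x ∈ E, IsAlgebraic A x) {y : K} (hy : Transcendental A y) :
    Transcendental E y := by
  have hle : E ≤ (Subalgebra.algebraicClosure A K).restrictScalars k := fun x hx => hE x hx
  rintro ⟨P, hP0, hP⟩
  apply hy
  have h2 : IsAlgebraic (Subalgebra.algebraicClosure A K) y := by
    let i : E →+* Subalgebra.algebraicClosure A K := (Subalgebra.inclusion hle).toRingHom
    have hi : Function.Injective i := Subalgebra.inclusion_injective hle
    refine ⟨P.map i, (Polynomial.map_ne_zero_iff hi).2 hP0, ?_⟩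
    rw [Polynomial.aeval_def, Polynomial.eval₂_map]
    exact hP
  exact h2.restrictScalars A

/-- `r` is transcendental over `C`. -/
theorem transcendental_r : Transcendental (C k D) (toFrac k (r k D)) := by
  have hv := algebraicIndependent_fgr k D
  set v : Fin 3 → Frac k := ![toFrac k (f k D), toFrac k (g k D), toFrac k (r k D)] with hvd
  have htr : Transcendental (Algebra.adjoin k (v '' {0, 1})) (v 2) :=
    hv.transcendental_adjoin (by decide)
  have hgen : ∀ i ∈ ({0, 1} : Set (Fin 3)),
      IsAlgebraic (Algebra.adjoin k (v '' {0, 1})) (v i) := fun i hi =>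
    isAlgebraic_algebraMap (⟨v i, Algebra.subset_adjoin ⟨i, hi, rfl⟩⟩ :
      Algebra.adjoin k (v '' {0, 1}))
  have hF : IsAlgebraic (Algebra.adjoin k (v '' {0, 1})) (toFrac k (f k D)) := hgen 0 (by simp)
  have hG : IsAlgebraic (Algebra.adjoin k (v '' {0, 1})) (toFrac k (g k D)) := hgen 1 (by simp)
  refine transcendental_of_forall_isAlgebraic _ _ (fun x hx => ?_) htr
  induction hx using Algebra.adjoin_induction with
  | mem x hx =>
    rcases hx with rfl | rfl | rfl | rfl
    · exact hF
    · exact hF.inv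
    · exact hG
    · exact hG.inv
  | algebraMap c =>
    rw [IsScalarTower.algebraMap_apply k (Algebra.adjoin k (v '' {0, 1})) (Frac k)]
    exact isAlgebraic_algebraMap _
  | add x y _ _ hx hy => exact hx.add hy
  | mul x y _ _ hx hy => exact hx.mul hy

/-- `C[r]`. -/
noncomputable def Cr : Subalgebra (C k D) (Frac k) :=
  Algebra.adjoin (C k D) {toFrac k (r k D)}

noncomputable instance : CommRing (Cr k D) := (Cr k D).toCommRing
noncomputable instance : IsDomain (Cr k D) := inferInstance
noncomputable instance : Algebra (C k D) (Cr k D) := (Cr k D).algebra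
noncomputable instance : Module (C k D) (Cr k D) := Algebra.toModule
noncomputable instance : SMul (C k D) (Cr k D) := Algebra.toSMul
noncomputable instance : Algebra k (Cr k D) := (Cr k D).algebra'
noncomputable instance : Module k (Cr k D) := Algebra.toModule
noncomputable instance : SMul k (Cr k D) := Algebra.toSMul
instance : IsScalarTower k (C k D) (Cr k D) := inferInstance
noncomputable instance : CommRing (Polynomial (Cr k D)) := Polynomial.commRing
noncomputable instance : IsDomain (Polynomial (Cr k D)) := inferInstance
noncomputable instance : Algebra k (Polynomial (Cr k D)) := Polynomial.algebraOfAlgebra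
noncomputable instance : Algebra (C k D) (Polynomial (Cr k D)) := Polynomial.algebraOfAlgebra
instance : IsScalarTower k (C k D) (Polynomial (Cr k D)) := inferInstance

theorem r_mem_Cr : toFrac k (r k D) ∈ Cr k D := Algebra.subset_adjoin rfl

theorem x_mem_of {S : Subalgebra (C k D) (Frac k)} (hr : toFrac k (r k D) ∈ S) (a : Poly k) :
    toFrac k a ∈ S := by
  have hc : ∀ {x : Frac k}, x ∈ C k D → x ∈ S := fun {x} hx =>
    S.algebraMap_mem (⟨x, hx⟩ : C k D)
  have hF := hc (f_mem_C k D)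
  have hFi := hc (f_inv_mem_C k D)
  have hG := hc (g_mem_C k D)
  have hGi := hc (g_inv_mem_C k D)
  have h0 : toFrac k (MvPolynomial.X 0) ∈ S := by
    rw [x0_eq k D]
    exact mul_mem hGi (add_mem (pow_mem hF _) (pow_mem hr _))
  have h1 : toFrac k (MvPolynomial.X 1) ∈ S := by
    rw [x1_eq k D]
    exact mul_mem (pow_mem hFi _) (sub_mem hr (pow_mem h0 _))
  have h2 : toFrac k (MvPolynomial.X 2) ∈ S := by
    rw [x2_eq k D]
    exact mul_mem (pow_mem hFi _) (sub_mem hG (mul_mem (pow_mem h0 _)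
      (sum_mem fun i _ => mul_mem (pow_mem hr _) (pow_mem (mul_mem (pow_mem hF _) h1) _))))
  induction a using MvPolynomial.induction_on with
  | C c =>
    have : toFrac k (MvPolynomial.C c) = algebraMap k (Frac k) c := (toFrac k).commutes c
    rw [this]
    exact hc ((C k D).algebraMap_mem c)
  | add a b ha hb => rw [map_add]; exact add_mem ha hb
  | mul_X a i ha =>
    rw [map_mul]
    refine mul_mem ha ?_
    fin_cases i
    · exact h0
    · exact h1
    · exact h2

/-- The inclusion `k[x₁, x₂, x₃] ⊆ C[r]`. -/
noncomputable def incl : Poly k →ₐ[k] Cr k D :=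
  (toFrac k).codRestrict ((Cr k D).restrictScalars k) (x_mem_of k D (r_mem_Cr k D))

theorem incl_injective : Function.Injective (incl k D) := fun _ _ h =>
  toFrac_injective k (congrArg Subtype.val h)

/-- `ε̃ : C[r] → C[r][T]`, `u(r) ↦ u(r + f ^ l g T)`. -/
noncomputable def epsilonTilde : Cr k D →ₐ[C k D] Polynomial (Cr k D) :=
  subst (transcendental_r k D) (Cr k D) rfl
    (Polynomial.C (incl k D (r k D)) +
      Polynomial.C (incl k D (f k D ^ D.l * g k D)) * Polynomial.X)

theorem epsilonTilde_r : epsilonTilde k D (incl k D (r k D)) =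
    Polynomial.C (incl k D (r k D)) +
      Polynomial.C (incl k D (f k D ^ D.l * g k D)) * Polynomial.X := by
  have h : incl k D (r k D) = ⟨toFrac k (r k D), r_mem_Cr k D⟩ := Subtype.ext rfl
  rw [epsilonTilde, h]
  exact subst_gen (transcendental_r k D) (Cr k D) rfl _ (r_mem_Cr k D)

/-- The inclusion `k[x₁, x₂, x₃][T] ⊆ C[r][T]`. -/
noncomputable def inclT : Polynomial (Poly k) →ₐ[k] Polynomial (Cr k D) :=
  Polynomial.mapAlgHom (incl k D)

theorem inclT_injective : Function.Injective (inclT k D) :=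
  Polynomial.map_injective (incl k D).toRingHom (incl_injective k D)

theorem inclT_C (a : Poly k) : inclT k D (Polynomial.C a) = Polynomial.C (incl k D a) := by
  simp [inclT]

theorem inclT_X : inclT k D Polynomial.X = Polynomial.X := by
  simp [inclT]

theorem epsilonTilde_of_mem (a : Poly k) (ha : toFrac k a ∈ C k D) :
    epsilonTilde k D (incl k D a) = inclT k D (Polynomial.C a) := by
  rw [inclT_C]
  exact (epsilonTilde k D).commutes ⟨toFrac k a, ha⟩

open Polynomial in
theorem dvd_of_dvd_mul (n : ℕ) (u y : Polynomial (Poly k))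
    (h : Polynomial.C (f k D) ^ n ∣
      (Polynomial.C (MvPolynomial.X 0) + Polynomial.C (f k D) * u) * y) :
    Polynomial.C (f k D) ^ n ∣ y := by
  have hx : Prime (Polynomial.C (MvPolynomial.X 0 : Poly k)) :=
    Polynomial.prime_C_iff.2 MvPolynomial.X_prime
  have hf0 : Polynomial.C (f k D) ≠ 0 := by simpa using f_ne_zero k D
  have hndvd : ¬ Polynomial.C (MvPolynomial.X 0 : Poly k) ∣ Polynomial.C (f k D) := by
    intro hd
    have hd : (MvPolynomial.X 0 : Poly k) ∣ f k D :=
      (Polynomial.C_dvd_iff_dvd_coeff _ _).1 hd 0 |>.trans (by simp)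
    obtain ⟨c, hc⟩ := hd
    have := congrArg (MvPolynomial.eval ![0, 1, 0]) hc
    simp [f] at this
  have key : ∀ y, Polynomial.C (f k D) ∣ Polynomial.C (MvPolynomial.X 0) * y →
      Polynomial.C (f k D) ∣ y := by
    rintro y ⟨b, hb⟩
    have : Polynomial.C (MvPolynomial.X 0 : Poly k) ∣ Polynomial.C (f k D) * b := ⟨y, hb.symm⟩
    obtain ⟨b', rfl⟩ := (hx.dvd_or_dvd this).resolve_left hndvd
    exact ⟨b', mul_left_cancel₀ hx.ne_zero (by linear_combination hb)⟩
  induction n with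
  | zero => simp
  | succ n ih =>
    obtain ⟨z, hz⟩ := ih ((pow_dvd_pow _ n.le_succ).trans h)
    obtain ⟨w, hw⟩ := h
    subst hz
    have h1 : (Polynomial.C (MvPolynomial.X 0) + Polynomial.C (f k D) * u) * z =
        Polynomial.C (f k D) * w := by
      apply mul_left_cancel₀ (pow_ne_zero n hf0)
      linear_combination hw
    have h2 : Polynomial.C (f k D) ∣ z :=
      key z ⟨w - u * z, by linear_combination h1⟩
    rw [pow_succ]
    exact mul_dvd_mul_left _ h2

/-- Auxiliary form of `epsilonTilde_incl_mem`. -/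
theorem mem_range_aux {B : Type*} [CommRing B] [IsDomain B] [Algebra k B]
    (ε : Poly k →ₐ[k] B) (j : Polynomial (Poly k) →ₐ[k] B) (hj : Function.Injective j)
    (T : Polynomial (Poly k)) (c : Poly k →+* Polynomial (Poly k)) (hcd : c = Polynomial.C)
    (hF : ε (f k D) = j (c (f k D))) (hG : ε (g k D) = j (c (g k D)))
    (hR : ε (r k D) = j (c (r k D) + c (f k D ^ D.l * g k D) * T)) (a : Poly k) :
    ε a ∈ j.range := by
  have hf0 : c (f k D) ≠ 0 := by simpa [hcd] using f_ne_zero k D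
  have hg0 : c (g k D) ≠ 0 := by simpa [hcd] using g_ne_zero k D
  have hjf0 : j (c (f k D)) ≠ 0 := (map_ne_zero_iff _ hj).2 hf0
  have hjg0 : j (c (g k D)) ≠ 0 := (map_ne_zero_iff _ hj).2 hg0
  set F := c (f k D) with hFd
  set G := c (g k D) with hGd
  set R := c (r k D) with hRd
  have hR' : ε (r k D) = j (R + F ^ D.l * G * T) := by rw [hR]; simp [F, G]
  set x0 := c (MvPolynomial.X 0) with hx0
  set x1 := c (MvPolynomial.X 1) with hx1
  set x2 := c (MvPolynomial.X 2) with hx2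
  have e1 : x0 * G = F ^ (D.l * D.t + 1) + R ^ D.t := by
    rw [hx0, hGd, ← map_mul, X_mul_g]; simp [F, R]
  have e2 : R = F ^ D.l * x1 + x0 ^ D.m := by
    simp only [hRd, r, map_add, map_mul, map_pow, ← hFd, ← hx0, ← hx1]
  obtain ⟨S, hS⟩ : ∃ S, (R + F ^ D.l * G * T) ^ D.t - R ^ D.t = F ^ D.l * G * T * S := by
    have := sub_dvd_pow_sub_pow (R + F ^ D.l * G * T) R D.t
    rwa [add_sub_cancel_left] at this
  have E0 : ε (MvPolynomial.X 0) = j (x0 + F ^ D.l * (T * S)) := by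
    apply mul_right_cancel₀ hjg0
    have h := congrArg ε (X_mul_g k D)
    rw [map_mul, map_add, map_pow ε, map_pow ε, hG, hF, hR', ← map_pow j, ← map_pow j, ← map_add] at h
    rw [h, ← map_mul]
    apply congrArg j
    linear_combination hS - e1
  obtain ⟨S', hS'⟩ : ∃ S', (x0 + F ^ D.l * (T * S)) ^ D.m - x0 ^ D.m =
      F ^ D.l * (T * S) * S' := by
    have := sub_dvd_pow_sub_pow (x0 + F ^ D.l * (T * S)) x0 D.m
    rwa [add_sub_cancel_left] at this
  have E1 : ε (MvPolynomial.X 1) = j (x1 + (G * T - T * S * S')) := by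
    apply mul_left_cancel₀ (pow_ne_zero D.l hjf0)
    have h : ε (r k D) = ε (f k D) ^ D.l * ε (MvPolynomial.X 1) + ε (MvPolynomial.X 0) ^ D.m := by
      rw [r]; simp only [map_add, map_mul, map_pow]
    rw [hR', hF, E0] at h
    have h' : j F ^ D.l * ε (MvPolynomial.X 1) =
        j (R + F ^ D.l * G * T - (x0 + F ^ D.l * (T * S)) ^ D.m) := by
      rw [map_sub, map_pow j (x0 + F ^ D.l * (T * S)), h]; ring
    rw [h', ← map_pow j, ← map_mul]
    apply congrArg j
    linear_combination e2 - hS'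
  set X0 := x0 + F ^ D.l * (T * S) with hX0
  set X1 := x1 + (G * T - T * S * S') with hX1
  have E2 : ∃ Z, ε (MvPolynomial.X 2) = j Z := by
    have ha : j X0 * ε (MvPolynomial.X 2) = j (F + X1 ^ D.t) := by
      rw [map_add j F, map_pow, ← E0, ← E1, ← hF, ← map_mul, ← map_pow, ← map_add]
      apply congrArg ε
      rw [f]; ring
    have hb : j F ^ (D.l * D.t) * ε (MvPolynomial.X 2) = j (G - X0 ^ (D.m - 1) *
        ∑ i ∈ Finset.range D.t, (R + F ^ D.l * G * T) ^ i * (F ^ D.l * X1) ^ (D.t - 1 - i)) := by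
      have h : ε (g k D) = ε (f k D) ^ (D.l * D.t) * ε (MvPolynomial.X 2) +
          ε (MvPolynomial.X 0) ^ (D.m - 1) * ∑ i ∈ Finset.range D.t, ε (r k D) ^ i *
            (ε (f k D) ^ D.l * ε (MvPolynomial.X 1)) ^ (D.t - 1 - i) := by
        rw [g]; simp only [map_add, map_mul, map_pow, map_sum]
      rw [hG, hF, hR', E0, E1] at h
      rw [map_sub, h]
      simp only [← map_pow, ← map_mul, ← map_sum]
      ring
    set Y := G - X0 ^ (D.m - 1) *
        ∑ i ∈ Finset.range D.t, (R + F ^ D.l * G * T) ^ i * (F ^ D.l * X1) ^ (D.t - 1 - i)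
    have hc : X0 * Y = F ^ (D.l * D.t) * (F + X1 ^ D.t) := by
      apply hj
      rw [map_mul, map_mul, ← ha, ← hb, map_pow]
      ring
    have hl : F ^ D.l = F * F ^ (D.l - 1) := by
      rw [← pow_succ', Nat.sub_add_cancel D.one_le_l]
    have hX0' : X0 = x0 + F * (F ^ (D.l - 1) * (T * S)) := by
      rw [hX0, hl]; ring
    have hd : F ^ (D.l * D.t) ∣ (x0 + F * (F ^ (D.l - 1) * (T * S))) * Y :=
      ⟨F + X1 ^ D.t, by rw [← hX0', hc]⟩
    rw [hx0, hFd, hcd] at hd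
    have hd' := dvd_of_dvd_mul k D _ _ _ hd
    rw [← hcd, ← hFd] at hd'
    obtain ⟨Z, hZ⟩ := hd'
    refine ⟨Z, ?_⟩
    apply mul_left_cancel₀ (pow_ne_zero (D.l * D.t) hjf0)
    rw [hb, hZ, map_mul j, map_pow j]
  induction a using MvPolynomial.induction_on with
  | C a =>
    have : ε (MvPolynomial.C a) = algebraMap k _ a := ε.commutes a
    rw [this]
    exact j.range.algebraMap_mem a
  | add a b ha hb => rw [map_add]; exact add_mem ha hb
  | mul_X a i ha =>
    rw [map_mul]
    refine mul_mem ha ?_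
    fin_cases i
    · exact ⟨_, E0.symm⟩
    · exact ⟨_, E1.symm⟩
    · exact E2.imp fun Z hZ => hZ.symm

/-- `ε̃` maps `k[x₁, x₂, x₃]` into `k[x₁, x₂, x₃][T]`. -/
theorem epsilonTilde_incl_mem (a : Poly k) :
    epsilonTilde k D (incl k D a) ∈ (inclT k D).range := by
  refine mem_range_aux k D (((epsilonTilde k D).restrictScalars k).comp (incl k D)) (inclT k D)
    (inclT_injective k D) Polynomial.X Polynomial.C rfl
    (epsilonTilde_of_mem k D _ (f_mem_C k D)) (epsilonTilde_of_mem k D _ (g_mem_C k D)) ?_ a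
  have h := epsilonTilde_r k D
  rw [← inclT_C, ← inclT_C, ← inclT_X, ← map_mul, ← map_add] at h
  exact h

/-- The `G_a`-action `ε : k[x₁, x₂, x₃] → k[x₁, x₂, x₃][T]`, the restriction of `ε̃`
(see `inclT_epsilon`). -/
noncomputable def epsilon : Poly k →ₐ[k] Polynomial (Poly k) :=
  (AlgEquiv.ofInjective (inclT k D) (inclT_injective k D)).symm.toAlgHom.comp
    ((((epsilonTilde k D).restrictScalars k).comp (incl k D)).codRestrict (inclT k D).range
      (epsilonTilde_incl_mem k D))

theorem inclT_epsilon (a : Poly k) :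
    inclT k D (epsilon k D a) = epsilonTilde k D (incl k D a) := by
  have h := AlgEquiv.apply_symm_apply (AlgEquiv.ofInjective (inclT k D) (inclT_injective k D))
    ⟨epsilonTilde k D (incl k D a), epsilonTilde_incl_mem k D a⟩
  exact congrArg Subtype.val h

/-- The invariant ring `k[x₁, x₂, x₃]^ε = {a | ε(a) = a}` of the `G_a`-action `ε`. -/
noncomputable def epsilonInvariants : Subalgebra k (Poly k) :=
  AlgHom.equalizer (epsilon k D) Polynomial.CAlgHom

/-- `ε_h : b ↦ ε(b)|_{T = h}`. -/
noncomputable def epsilonAt (h : Poly k) : Poly k →ₐ[k] Poly k :=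
  ((Polynomial.aeval h).restrictScalars k).comp (epsilon k D)

/-- The invariant ring `{b | φ(b) = b}` of an endomorphism `φ` of `k[x₁, x₂, x₃]`. -/
noncomputable def invariants (φ : Poly k →ₐ[k] Poly k) : Subalgebra k (Poly k) :=
  AlgHom.equalizer φ (AlgHom.id k (Poly k))

variable (p : ℕ) [hp : Fact p.Prime]

/-- `C[r ^ p]`. -/
noncomputable def Crp : Subalgebra (C k D) (Frac k) :=
  Algebra.adjoin (C k D) {toFrac k (r k D) ^ p}

noncomputable instance : CommRing (Crp k D p) := (Crp k D p).toCommRing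
noncomputable instance : IsDomain (Crp k D p) := inferInstance
noncomputable instance : Algebra (C k D) (Crp k D p) := (Crp k D p).algebra
noncomputable instance : Module (C k D) (Crp k D p) := Algebra.toModule
noncomputable instance : SMul (C k D) (Crp k D p) := Algebra.toSMul
noncomputable instance : Algebra k (Crp k D p) := (Crp k D p).algebra'
noncomputable instance : Module k (Crp k D p) := Algebra.toModule
noncomputable instance : SMul k (Crp k D p) := Algebra.toSMul
instance : IsScalarTower k (C k D) (Crp k D p) := inferInstance

/-- `q = r ^ p - (f ^ l g h) ^ (p - 1) r`. -/
noncomputable def q (h : Poly k) : Poly k :=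
  r k D ^ p - (f k D ^ D.l * g k D * h) ^ (p - 1) * r k D

/-- `C[q]`. -/
noncomputable def Cq (h : Poly k) : Subalgebra (C k D) (Frac k) :=
  Algebra.adjoin (C k D) {toFrac k (q k D p h)}

noncomputable instance (h : Poly k) : CommRing (Cq k D p h) := (Cq k D p h).toCommRing
noncomputable instance (h : Poly k) : IsDomain (Cq k D p h) := inferInstance
noncomputable instance (h : Poly k) : Algebra (C k D) (Cq k D p h) := (Cq k D p h).algebra
noncomputable instance (h : Poly k) : Module (C k D) (Cq k D p h) := Algebra.toModule
noncomputable instance (h : Poly k) : SMul (C k D) (Cq k D p h) := Algebra.toSMul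
noncomputable instance (h : Poly k) : Algebra k (Cq k D p h) := (Cq k D p h).algebra'
noncomputable instance (h : Poly k) : Module k (Cq k D p h) := Algebra.toModule
noncomputable instance (h : Poly k) : SMul k (Cq k D p h) := Algebra.toSMul
instance (h : Poly k) : IsScalarTower k (C k D) (Cq k D p h) := inferInstance

/-- `ψ : C[r ^ p] → C[q]`, `u(r ^ p) ↦ u(q)`. -/
noncomputable def psi (h : Poly k) : Crp k D p →ₐ[C k D] Cq k D p h :=
  subst ((transcendental_r k D).pow hp.out.pos) (Crp k D p) rfl
    ⟨toFrac k (q k D p h), Algebra.subset_adjoin rfl⟩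

/-- `ψ` with values in `k(x₁, x₂, x₃) ⊇ C[q]`, as a homomorphism of `k`-algebras. -/
noncomputable def psiFrac (h : Poly k) : Crp k D p →ₐ[k] Frac k :=
  ((Cq k D p h).val.comp (psi k D p h)).restrictScalars k

theorem x_pow_mem_Crp [CharP k p] (i : Fin 3) :
    toFrac k (MvPolynomial.X i) ^ p ∈ Crp k D p := by
  have : CharP (Frac k) p := charP_of_injective_algebraMap (algebraMap k (Frac k)).injective p
  have hr : toFrac k (r k D) ^ p ∈ Crp k D p := Algebra.subset_adjoin rfl
  have hc : ∀ {x : Frac k}, x ∈ C k D → frobenius (Frac k) p x ∈ Crp k D p := fun {x} hx =>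
    pow_mem ((Crp k D p).algebraMap_mem (⟨x, hx⟩ : C k D)) p
  have hr' : frobenius (Frac k) p (toFrac k (r k D)) ∈ Crp k D p := hr
  have hF := hc (f_mem_C k D)
  have hFi := hc (f_inv_mem_C k D)
  have hG := hc (g_mem_C k D)
  have hGi := hc (g_inv_mem_C k D)
  have h0 : frobenius (Frac k) p (toFrac k (MvPolynomial.X 0)) ∈ Crp k D p := by
    rw [x0_eq k D]
    simp only [map_mul, map_add, map_pow] at *
    exact mul_mem hGi (add_mem (pow_mem hF _) (pow_mem hr' _))
  have h1 : frobenius (Frac k) p (toFrac k (MvPolynomial.X 1)) ∈ Crp k D p := by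
    rw [x1_eq k D, map_mul, map_sub, map_pow, map_pow]
    exact mul_mem (pow_mem hFi _) (sub_mem hr' (pow_mem h0 _))
  have h2 : frobenius (Frac k) p (toFrac k (MvPolynomial.X 2)) ∈ Crp k D p := by
    rw [x2_eq k D, map_mul, map_sub, map_mul, map_sum, map_pow, map_pow]
    refine mul_mem (pow_mem hFi _) (sub_mem hG (mul_mem (pow_mem h0 _) (sum_mem fun i _ => ?_)))
    rw [map_mul, map_pow, map_pow, map_mul, map_pow]
    exact mul_mem (pow_mem hr' _) (pow_mem (mul_mem (pow_mem hF _) h1) _)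
  fin_cases i
  · exact h0
  · exact h1
  · exact h2

/-- `xᵢ ^ p` as an element of `C[r ^ p]`. -/
noncomputable def xPow [CharP k p] (i : Fin 3) : Crp k D p :=
  ⟨toFrac k (MvPolynomial.X i) ^ p, x_pow_mem_Crp k D p i⟩

/-- `f` as an element of `C[r ^ p]`. -/
noncomputable def fCrp : Crp k D p :=
  ⟨toFrac k (f k D), (Crp k D p).algebraMap_mem (⟨_, f_mem_C k D⟩ : C k D)⟩

/-- `g` as an element of `C[r ^ p]`. -/
noncomputable def gCrp : Crp k D p :=
  ⟨toFrac k (g k D), (Crp k D p).algebraMap_mem (⟨_, g_mem_C k D⟩ : C k D)⟩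

open MvPolynomial in
/-- The ideal `(y ^ p - f, z ^ p - g)` of `k[x₁, x₂, x₃, y, z]`, where the five variables are
`X 0, X 1, X 2, X 3, X 4`. -/
noncomputable def relIdeal : Ideal (MvPolynomial (Fin 5) k) :=
  Ideal.span {X 3 ^ p - rename (Fin.castAdd 2) (f k D), X 4 ^ p - rename (Fin.castAdd 2) (g k D)}

end RankThree

/-! Put a = f^l g h. Since h lies in C, the automorphism ε_h is the translation r ↦ r + a over C, so
an invariant lies in C[q], where q = r^p - a^(p-1) r (`toFrac_mem_Cq_of_mem_invariants`). The
divisibility of h^(p-1) by f^(l+1) g^2 makes q so close to r^p that each yᵢ = ψ(xᵢ^p) is a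
polynomial congruent to xᵢ^p modulo f g (`exists_psi_X_pow`). Let A = k[y₁, y₂, y₃, f, g]. Then C[q]
= A[1/(f g)], and (i) says that a polynomial in A[1/(f g)] is in A, which follows once an element of
A divisible by f, or by g, in k[x] has its quotient in A.

As ψ is injective, fixes f and g and moves xᵢ^p only modulo f g, it suffices to prove this for
k[x₁^p, x₂^p, x₃^p, f, g] (`exists_subHom_eq_mul`). An element there is ∑ s_ij(x^p) f^i g^j with i,
j < p. If f divides it, then f divides ∑ s_0j(x^p) g^j. A derivation that kills f, and whose value
at g is coprime to f, forces f to divide every s_0j(x^p). Another derivation raises this to f^p, and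
f^p = f(x^p) because f has coefficients in the prime field. Hence f divides s_0j, and a factor f
comes out (`exists_eq_mul_sum_expand`). For g the argument is the same. The required coprimality
comes from p ∤ mt - 1 for f and from p ∤ t for g.

For (ii), the Jacobian of x₁, f, g is nonzero, so the f^i g^j with i, j < p are independent over
k[x^p]. All relations therefore come from y^p = f and z^p = g (`ker_powHom`, `ker_subHom`). Neither
relation has a term of degree less than 2, so the tangent space at the origin has dimension 5, too
large for affine 3-space (`isEmpty_algEquiv_of_tangentHom_eq_zero`). -/

namespace RankThree

/-! ### Derivations and divisibility in characteristic p -/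

section General

/-- In characteristic `p`, if a derivation `d` kills `s` and `a` is coprime to `d a`, then `a ∣ s`
implies `a ^ p ∣ s`. -/
theorem pow_dvd_of_derivation {k A : Type*} [Field k] [CommRing A] [IsDomain A]
    [DecompositionMonoid A] [Algebra k A] (p : ℕ) [Fact p.Prime] [CharP k p]
    (d : Derivation k A A) {a s : A} (hd : d s = 0) (ha : a ∣ s) (hrel : IsRelPrime a (d a)) :
    a ^ p ∣ s := by
  rcases eq_or_ne a 0 with rfl | ha0
  · rw [zero_dvd_iff.1 ha]; exact dvd_zero _
  suffices H : ∀ j, j ≤ p → a ^ j ∣ s from H p le_rfl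
  intro j
  induction j with
  | zero => simp
  | succ j ih =>
    intro hj
    rcases Nat.eq_zero_or_pos j with rfl | hj0
    · simpa using ha
    obtain ⟨w, rfl⟩ := ih (by omega)
    -- This is `d (a ^ j * w) = 0`. As `0 < j < p`, the integer `j` is invertible, so `a ∣ d a * w`,
    -- and coprimality gives one more factor `a`.
    have h1 : a ^ (j - 1) * ((j : A) * (d a * w) + a * d w) = 0 := by
      have h2 := hd
      rw [Derivation.leibniz, Derivation.leibniz_pow] at h2
      simp only [smul_eq_mul, nsmul_eq_mul] at h2
      have h3 : a ^ j = a ^ (j - 1) * a := by rw [← pow_succ, Nat.sub_add_cancel hj0]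
      rw [h3] at h2
      linear_combination h2
    have h2 := (mul_eq_zero.1 h1).resolve_left (pow_ne_zero _ ha0)
    have hju : IsUnit (j : A) := by
      have : (j : k) ≠ 0 := by
        rw [Ne, CharP.cast_eq_zero_iff k p]
        exact fun h => absurd (Nat.le_of_dvd hj0 h) (by omega)
      simpa using this.isUnit.map (algebraMap k A)
    have h3 : a ∣ w := by
      refine hrel.dvd_of_dvd_mul_left (hju.dvd_mul_left.1 ⟨-d w, ?_⟩)
      linear_combination h2
    rw [pow_succ]
    exact mul_dvd_mul_left _ h3

/-- In characteristic `p`, let `d` be a derivation with `d a = 0` for which `d b` is a nonzero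
divisor modulo `a`. Then `1, b, …, b ^ (p - 1)` are independent modulo `a` over the kernel
of `d`. -/
theorem dvd_of_dvd_sum_of_derivation {k A : Type*} [Field k] [CommRing A] [Algebra k A]
    (p : ℕ) [CharP k p] (d : Derivation k A A) {a b : A} (hda : d a = 0)
    (hdb : ∀ w, a ∣ d b * w → a ∣ w) (n : ℕ) (hn : n ≤ p) (s : ℕ → A) (hs : ∀ i, d (s i) = 0)
    (h : a ∣ ∑ i ∈ Finset.range n, s i * b ^ i) (i : ℕ) (hi : i < n) : a ∣ s i := by
  induction n generalizing s i with
  | zero => omega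
  | succ n ih =>
    -- Applying `d` amounts to differentiating in `b` and multiplying by `d b`, which can be
    -- cancelled modulo `a`. The factors `i + 1 < p` are invertible; the lost term `s 0` is
    -- recovered at the end by subtraction.
    have h1 : a ∣ ∑ i ∈ Finset.range n, ((i + 1 : ℕ) : A) * s (i + 1) * b ^ i := by
      apply hdb
      obtain ⟨c, hc⟩ := h
      refine ⟨d c, ?_⟩
      have h2 := congrArg d hc
      rw [Derivation.leibniz, hda, smul_zero, add_zero, smul_eq_mul, map_sum,
        Finset.sum_range_succ'] at h2
      rw [← h2, Finset.mul_sum]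
      simp only [Derivation.leibniz, Derivation.leibniz_pow, hs, smul_eq_mul, nsmul_eq_mul]
      simp only [Nat.add_sub_cancel]
      simp
      refine Finset.sum_congr rfl fun i _ => by ring
    have hS : ∀ i < n, a ∣ s (i + 1) := by
      intro i hi
      have h2 := ih (by omega) (fun i => ((i + 1 : ℕ) : A) * s (i + 1))
        (fun i => by simp [hs]) h1 i hi
      have hu : IsUnit ((i + 1 : ℕ) : A) := by
        have : ((i + 1 : ℕ) : k) ≠ 0 := by
          rw [Ne, CharP.cast_eq_zero_iff k p]
          exact fun h => absurd (Nat.le_of_dvd i.succ_pos h) (by omega)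
        simpa using this.isUnit.map (algebraMap k A)
      exact hu.dvd_mul_left.1 h2
    rcases i with _ | i
    · rw [Finset.sum_range_succ'] at h
      have h3 : a ∣ ∑ i ∈ Finset.range n, s (i + 1) * b ^ (i + 1) :=
        Finset.dvd_sum fun i hi => (hS i (Finset.mem_range.1 hi)).mul_right _
      simpa using (dvd_add_right h3).1 h
    · exact hS i (by omega)

/-- In characteristic `p`, a polynomial killed by all partial derivatives is a polynomial in the
`p`-th powers of the variables. -/
theorem exists_expand_of_pderiv_eq_zero {σ k : Type*} [Field k] (p : ℕ) [Fact p.Prime]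
    [CharP k p] (s : MvPolynomial σ k) (hs : ∀ i, MvPolynomial.pderiv i s = 0) :
    ∃ s', s = MvPolynomial.expand p s' := by
  classical
  suffices H : s ∈ (MvPolynomial.expand (σ := σ) (R := k) p).range by
    obtain ⟨s', hs'⟩ := H
    exact ⟨s', hs'.symm⟩
  rw [s.as_sum]
  refine sum_mem fun m hm => ?_
  have hdvd : ∀ i, p ∣ m i := by
    intro i
    by_contra hpi
    have hmi : m i ≠ 0 := fun h => hpi (h ▸ dvd_zero p)
    have h1 := congrArg (MvPolynomial.coeff (m - Finsupp.single i 1)) (hs i)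
    have hle : Finsupp.single i 1 ≤ m := by
      rw [Finsupp.single_le_iff]; omega
    rw [MvPolynomial.coeff_pderiv, tsub_add_cancel_of_le hle, MvPolynomial.coeff_zero] at h1
    have h2 : ((m i : ℕ) : k) ≠ 0 := by rwa [Ne, CharP.cast_eq_zero_iff k p]
    have h3 := MvPolynomial.mem_support_iff.1 hm
    have h4 : ((m i - 1 : ℕ) : k) + 1 = ((m i : ℕ) : k) := by
      rw [Nat.cast_sub (by omega)]; simp
    simp [h2, h3, h4] at h1
  refine ⟨MvPolynomial.monomial (m.mapRange (· / p) (by simp)) (MvPolynomial.coeff m s), ?_⟩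
  have : p • m.mapRange (· / p) (by simp) = m := by
    ext i
    simp [Nat.mul_div_cancel' (hdvd i)]
  simp [MvPolynomial.expand_monomial, this]

theorem derivation_expand {σ k : Type*} [Field k] (p : ℕ) [CharP k p]
    (d : Derivation k (MvPolynomial σ k) (MvPolynomial σ k)) (s : MvPolynomial σ k) :
    d (MvPolynomial.expand p s) = 0 := by
  induction s using MvPolynomial.induction_on with
  | C c => rw [MvPolynomial.expand_C]; exact d.map_algebraMap c
  | add a b ha hb => rw [map_add, map_add, ha, hb, add_zero]
  | mul_X a i ha =>
    rw [map_mul, Derivation.leibniz, ha, MvPolynomial.expand_X, Derivation.leibniz_pow]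
    simp

/-- If `a` divides `expand p s` and `expand p a = a ^ p`, and some derivative of `a` is coprime
to `a`, then `a` divides `s`. -/
theorem dvd_of_dvd_expand {σ k : Type*} [Field k] (p : ℕ) [hp : Fact p.Prime]
    [CharP k p] [DecompositionMonoid (MvPolynomial σ k)] {a s : MvPolynomial σ k}
    (hap : MvPolynomial.expand p a = a ^ p)
    (d : Derivation k (MvPolynomial σ k) (MvPolynomial σ k)) (hrel : IsRelPrime a (d a))
    (h : a ∣ MvPolynomial.expand p s) : a ∣ s := by
  rcases eq_or_ne a 0 with rfl | ha0
  · rw [zero_dvd_iff, MvPolynomial.expand_eq_zero hp.out.pos] at h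
    rw [h]
  obtain ⟨w, hw⟩ := pow_dvd_of_derivation p d (derivation_expand p d s) h hrel
  rw [← hap] at hw
  -- The cofactor `w` is a quotient of two elements killed by every partial derivative, hence is
  -- killed too and is itself an expansion.
  obtain ⟨w', rfl⟩ := exists_expand_of_pderiv_eq_zero p w fun i => by
    have h1 := congrArg (MvPolynomial.pderiv i) hw
    rw [Derivation.leibniz, derivation_expand, derivation_expand, smul_zero, add_zero,
      smul_eq_mul] at h1
    refine (mul_eq_zero.1 h1.symm).resolve_left ?_
    rwa [MvPolynomial.expand_eq_zero hp.out.pos]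
  rw [← map_mul] at hw
  exact ⟨w', MvPolynomial.expand_injective hp.out.pos hw⟩

end General

/-! ### Coprimality of x₁, f, g, r and the derivations adapted to f and g -/

variable (k : Type*) [Field k] (D : Params)

theorem isRelPrime_X_f : IsRelPrime (MvPolynomial.X 0) (f k D) := by
  refine (MvPolynomial.X_prime.irreducible.isRelPrime_iff_not_dvd).2 ?_
  rintro ⟨c, hc⟩
  have := congrArg (MvPolynomial.eval ![0, 1, 0]) hc
  simp [f] at this

theorem isRelPrime_X_g : IsRelPrime (MvPolynomial.X 0) (g k D) := by
  refine (MvPolynomial.X_prime.irreducible.isRelPrime_iff_not_dvd).2 ?_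
  rintro ⟨c, hc⟩
  -- At these two points x₁ = 0 and f, r agree; only x₃ differs. The values of g then differ by
  -- f^(lt) = ±1, whatever the sum contributes when m = 1.
  have h0 := congrArg (MvPolynomial.eval ![0, 1, 0]) hc
  have h1 := congrArg (MvPolynomial.eval ![0, 1, 1]) hc
  simp only [g, f, r, map_add, map_mul, map_pow, map_sub, map_sum, MvPolynomial.eval_X,
    Matrix.cons_val_zero, Matrix.cons_val_one, Matrix.cons_val, zero_mul, one_pow, zero_sub,
    mul_zero, mul_one, zero_add] at h0 h1
  have h2 : ((-1 : k)) ^ (D.l * D.t) = 0 := by linear_combination h1 - h0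
  simp at h2

/-- Modulo f, r is x₁^m, and x₁ is coprime to f. -/
theorem isRelPrime_f_r : IsRelPrime (f k D) (r k D) := by
  have h : IsRelPrime (f k D) (MvPolynomial.X 0 ^ D.m) := ((isRelPrime_X_f k D).symm).pow_right
  have hl : f k D ^ D.l = f k D * f k D ^ (D.l - 1) := by
    rw [← pow_succ', Nat.sub_add_cancel D.one_le_l]
  have : MvPolynomial.X 0 ^ D.m =
      r k D + f k D * (- f k D ^ (D.l - 1) * MvPolynomial.X 1) := by
    rw [r, hl]; ring
  rw [this] at h
  exact h.of_add_mul_left_right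

/-- Modulo f, x₁ g is r^t, and r is coprime to f. -/
theorem isRelPrime_f_g : IsRelPrime (f k D) (g k D) := by
  have h : IsRelPrime (f k D) (r k D ^ D.t) := (isRelPrime_f_r k D).pow_right
  have h1 : r k D ^ D.t = MvPolynomial.X 0 * g k D + f k D * (- f k D ^ (D.l * D.t)) := by
    rw [X_mul_g]; ring
  rw [h1] at h
  exact h.of_add_mul_left_right.of_mul_right_right

theorem isRelPrime_g_r : IsRelPrime (g k D) (r k D) := by
  intro d hg hr
  have h1 : d ∣ f k D ^ (D.l * D.t + 1) := by
    have h2 : f k D ^ (D.l * D.t + 1) = MvPolynomial.X 0 * g k D - r k D ^ D.t := by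
      rw [X_mul_g]; ring
    rw [h2]
    refine dvd_sub (hg.mul_left _) (hr.trans (dvd_pow_self _ ?_))
    have := D.two_le_t; omega
  exact (isRelPrime_f_g k D).pow_left h1 hg

variable (p : ℕ) [CharP k p]

/-- `∂f/∂x₃ = x₁`. -/
theorem pderiv_two_f : MvPolynomial.pderiv 2 (f k D) = MvPolynomial.X 0 := by
  simp [f, MvPolynomial.pderiv_X]

theorem pderiv_zero_f : MvPolynomial.pderiv 0 (f k D) = MvPolynomial.X 2 := by
  simp [f, MvPolynomial.pderiv_X]

theorem pderiv_one_f :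
    MvPolynomial.pderiv 1 (f k D) = - ((D.t : Poly k) * MvPolynomial.X 1 ^ (D.t - 1)) := by
  simp [f, MvPolynomial.pderiv_X]

/-- The derivation `x₁ ∂₁ - x₃ ∂₃`, which kills `f`. -/
noncomputable def derivF : Derivation k (Poly k) (Poly k) :=
  (MvPolynomial.X 0 : Poly k) • MvPolynomial.pderiv 0 -
    (MvPolynomial.X 2 : Poly k) • MvPolynomial.pderiv 2

theorem derivF_f : derivF k (f k D) = 0 := by
  simp [derivF, pderiv_two_f, pderiv_zero_f]; ring

/-- Modulo f, x₁ g is x₁^(mt), so g behaves like x₁^(mt-1), and the derivation fixes x₁. Hence x₁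
times its value at g is (mt - 1) x₁^(mt) modulo f, a unit times a power of x₁. -/
theorem isRelPrime_derivF_g (hpmt : ¬ p ∣ D.m * D.t - 1) :
    IsRelPrime (f k D) (derivF k (g k D)) := by
  have hm := D.one_le_m
  have ht := D.two_le_t
  have hl := D.one_le_l
  have hmt := D.three_le_mt
  have hX0 : derivF k (MvPolynomial.X 0) = MvPolynomial.X 0 := by
    simp [derivF, MvPolynomial.pderiv_X]
  have hX1 : derivF k (MvPolynomial.X 1) = 0 := by
    simp [derivF, MvPolynomial.pderiv_X]
  have hr : derivF k (r k D) = (D.m : Poly k) * MvPolynomial.X 0 ^ D.m := by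
    rw [r, map_add, Derivation.leibniz, Derivation.leibniz_pow, Derivation.leibniz_pow, derivF_f,
      hX0, hX1]
    simp only [smul_eq_mul, nsmul_eq_mul, mul_zero, add_zero, smul_zero, zero_add]
    rw [← pow_succ, Nat.sub_add_cancel hm]
  have hg := congrArg (derivF k) (X_mul_g k D)
  rw [Derivation.leibniz, map_add, Derivation.leibniz_pow, Derivation.leibniz_pow, derivF_f, hX0,
    hr] at hg
  simp only [smul_eq_mul, nsmul_eq_mul, mul_zero, zero_add] at hg
  have hl' : f k D ^ D.l = f k D * f k D ^ (D.l - 1) := by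
    rw [← pow_succ', Nat.sub_add_cancel hl]
  have hdr : ∀ n, f k D ∣ r k D ^ n - (MvPolynomial.X 0 ^ D.m) ^ n := fun n => by
    refine (Dvd.dvd.trans ⟨f k D ^ (D.l - 1) * MvPolynomial.X 1, ?_⟩ (sub_dvd_pow_sub_pow _ _ n))
    rw [r, hl']; ring
  obtain ⟨u, hu⟩ := hdr (D.t - 1)
  obtain ⟨v, hv⟩ := hdr D.t
  have hc : ((D.m * D.t - 1 : ℕ) : Poly k) = (D.m : Poly k) * D.t - 1 := by
    rw [Nat.cast_sub (by omega)]; push_cast; ring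
  have hpw : ((MvPolynomial.X 0 : Poly k) ^ D.m) ^ D.t =
      ((MvPolynomial.X 0 : Poly k) ^ D.m) ^ (D.t - 1) * (MvPolynomial.X 0 : Poly k) ^ D.m := by
    rw [← pow_succ, Nat.sub_add_cancel (by omega)]
  have key : MvPolynomial.X 0 * derivF k (g k D) + f k D * (f k D ^ (D.l * D.t) + v -
      (D.t : Poly k) * (D.m : Poly k) * MvPolynomial.X 0 ^ D.m * u) =
      ((D.m * D.t - 1 : ℕ) : Poly k) * MvPolynomial.X 0 ^ (D.m * D.t) := by
    rw [hc, pow_mul]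
    have h2 := X_mul_g k D
    rw [pow_succ] at h2
    linear_combination hg - h2 - hv +
      (D.t : Poly k) * (D.m : Poly k) * MvPolynomial.X 0 ^ D.m * hu -
      (D.t : Poly k) * (D.m : Poly k) * hpw
  have hu : IsUnit ((D.m * D.t - 1 : ℕ) : Poly k) := by
    have : ((D.m * D.t - 1 : ℕ) : k) ≠ 0 := by rwa [Ne, CharP.cast_eq_zero_iff k p]
    simpa only [map_natCast] using this.isUnit.map (algebraMap k (Poly k))
  have hrel : IsRelPrime (f k D)
      (((D.m * D.t - 1 : ℕ) : Poly k) * MvPolynomial.X 0 ^ (D.m * D.t)) :=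
    hu.isRelPrime_right.mul_right ((isRelPrime_X_f k D).symm.pow_right)
  rw [← key] at hrel
  exact hrel.of_add_mul_left_right.of_mul_right_right

/-- The derivation `x₁ ∂₂ + t x₂ ^ (t - 1) ∂₃`, which kills `x₁` and `f`. -/
noncomputable def derivXF : Derivation k (Poly k) (Poly k) :=
  (MvPolynomial.X 0 : Poly k) • MvPolynomial.pderiv 1 +
    ((D.t : Poly k) * MvPolynomial.X 1 ^ (D.t - 1)) • MvPolynomial.pderiv 2

theorem derivXF_f : derivXF k D (f k D) = 0 := by
  simp [derivXF, pderiv_two_f, pderiv_one_f]; ring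

/-- Apply the derivation to x₁ g = f^(lt+1) + r^t: it kills x₁ and f and sends r to f^l x₁, so x₁
cancels. -/
theorem derivXF_g : derivXF k D (g k D) = (D.t : Poly k) * r k D ^ (D.t - 1) * f k D ^ D.l := by
  have hX0 : derivXF k D (MvPolynomial.X 0) = 0 := by
    simp [derivXF, MvPolynomial.pderiv_X]
  have hX1 : derivXF k D (MvPolynomial.X 1) = MvPolynomial.X 0 := by
    simp [derivXF, MvPolynomial.pderiv_X]
  have hr : derivXF k D (r k D) = f k D ^ D.l * MvPolynomial.X 0 := by
    rw [r, map_add, Derivation.leibniz, Derivation.leibniz_pow, Derivation.leibniz_pow, derivXF_f,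
      hX0, hX1]
    simp
  have hg := congrArg (derivXF k D) (X_mul_g k D)
  rw [Derivation.leibniz, map_add, Derivation.leibniz_pow, Derivation.leibniz_pow, derivXF_f, hX0,
    hr] at hg
  simp only [smul_eq_mul, nsmul_eq_mul, mul_zero, zero_add, add_zero] at hg
  apply mul_left_cancel₀ (MvPolynomial.X_ne_zero (R := k) (0 : Fin 3))
  linear_combination hg

theorem derivXF_g_ne_zero (hpt : ¬ p ∣ D.t) : derivXF k D (g k D) ≠ 0 := by
  have h1 : (D.t : Poly k) ≠ 0 := by rwa [Ne, CharP.cast_eq_zero_iff (Poly k) p]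
  have h2 : r k D ≠ 0 := by
    intro h
    have := isRelPrime_f_r k D
    rw [h, isRelPrime_zero_right] at this
    have h3 := this.map (MvPolynomial.eval ![0, 0, 0])
    have ht : D.t ≠ 0 := by have := D.two_le_t; omega
    simp [f, ht] at h3
  rw [derivXF_g]
  exact mul_ne_zero (mul_ne_zero h1 (pow_ne_zero _ h2)) (pow_ne_zero _ (f_ne_zero k D))

theorem isRelPrime_derivXF_g (hpt : ¬ p ∣ D.t) : IsRelPrime (g k D) (derivXF k D (g k D)) := by
  have hu : IsUnit (D.t : Poly k) := by
    have : (D.t : k) ≠ 0 := by rwa [Ne, CharP.cast_eq_zero_iff k p]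
    simpa only [map_natCast] using this.isUnit.map (algebraMap k (Poly k))
  rw [derivXF_g]
  exact (hu.isRelPrime_right.mul_right (isRelPrime_g_r k D).pow_right).mul_right
    (isRelPrime_f_g k D).symm.pow_right

/-- The derivation `(∂g/∂x₂) ∂₃ - (∂g/∂x₃) ∂₂`, which kills `x₁` and `g`. -/
noncomputable def derivXG : Derivation k (Poly k) (Poly k) :=
  MvPolynomial.pderiv 1 (g k D) • MvPolynomial.pderiv 2 -
    MvPolynomial.pderiv 2 (g k D) • MvPolynomial.pderiv 1

theorem derivXG_g : derivXG k D (g k D) = 0 := by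
  simp [derivXG]; ring

/-- Up to sign, both sides are the Jacobian determinant of x₁, f, g. -/
theorem derivXG_f : derivXG k D (f k D) = derivXF k D (g k D) := by
  simp [derivXG, derivXF, pderiv_two_f, pderiv_one_f]; ring

variable [hp : Fact p.Prime]

/-- The coefficients of f lie in the prime field, so Frobenius acts on the variables only. -/
theorem expand_f : MvPolynomial.expand p (f k D) = f k D ^ p := by
  rw [f, map_sub, map_mul, map_pow]
  simp only [MvPolynomial.expand_X]
  rw [sub_pow_char]; ring

theorem expand_r : MvPolynomial.expand p (r k D) = r k D ^ p := by
  rw [r, map_add, map_mul, map_pow, map_pow, expand_f]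
  simp only [MvPolynomial.expand_X]
  rw [add_pow_char]; ring

theorem expand_g : MvPolynomial.expand p (g k D) = g k D ^ p := by
  apply mul_left_cancel₀ (pow_ne_zero p (MvPolynomial.X_ne_zero (R := k) (0 : Fin 3)))
  rw [← mul_pow, X_mul_g, ← MvPolynomial.expand_X, ← map_mul, X_mul_g, map_add, map_pow, map_pow,
    expand_f, expand_r, add_pow_char]
  ring

end RankThree

/-! ### The ring k[x₁^p, x₂^p, x₃^p, f, g]: normal form, division by f and g, relations -/

namespace RankThree

section General

/-- Multiplication by `y` shifts the coefficients, and the top one wraps round with a factor `y ^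
n`. With `n = p`, that factor becomes f or g in the quotient ring. -/
theorem mul_sum_mul_pow {B : Type*} [CommRing B] (n : ℕ) (hn : 0 < n) (c : ℕ → B) (y : B) :
    (∑ i ∈ Finset.range n, c i * y ^ i) * y =
      ∑ i ∈ Finset.range n, (if i = 0 then y ^ n * c (n - 1) else c (i - 1)) * y ^ i := by
  obtain ⟨m, rfl⟩ : ∃ m, n = m + 1 := ⟨n - 1, by omega⟩
  rw [Finset.sum_range_succ, Finset.sum_range_succ', add_mul, Finset.sum_mul]
  simp only [Nat.add_sub_cancel, if_true, Nat.succ_ne_zero, if_false, pow_zero, mul_one]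
  congr 1
  · exact Finset.sum_congr rfl fun i _ => by ring
  · ring

/-- Elements `∑ expand(s i j) a ^ i b ^ j` divisible by `a` are of the form `a` times an element
of the same kind, if `b` is sufficiently independent of `a`. -/
theorem exists_eq_mul_sum_expand {σ k : Type*} [Field k] (p : ℕ) [hp : Fact p.Prime]
    [CharP k p] [DecompositionMonoid (MvPolynomial σ k)] {a b : MvPolynomial σ k}
    (hap : MvPolynomial.expand p a = a ^ p)
    (d d' : Derivation k (MvPolynomial σ k) (MvPolynomial σ k)) (hrel : IsRelPrime a (d a))
    (hda : d' a = 0) (hrel' : IsRelPrime a (d' b)) (s : ℕ → ℕ → MvPolynomial σ k)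
    (h : a ∣ ∑ i ∈ Finset.range p, ∑ j ∈ Finset.range p,
      MvPolynomial.expand p (s i j) * a ^ i * b ^ j) :
    ∃ s' : ℕ → ℕ → MvPolynomial σ k,
      ∑ i ∈ Finset.range p, ∑ j ∈ Finset.range p, MvPolynomial.expand p (s i j) * a ^ i * b ^ j =
      a * ∑ i ∈ Finset.range p, ∑ j ∈ Finset.range p,
        MvPolynomial.expand p (s' i j) * a ^ i * b ^ j := by
  obtain ⟨n, hn⟩ : ∃ n, p = n + 1 := ⟨p - 1, by have := hp.out.pos; omega⟩
  -- The terms with `i > 0` are visibly divisible by `a`, so only those with `i = 0` carry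
  -- information.
  have h1 : a ∣ ∑ j ∈ Finset.range p, MvPolynomial.expand p (s 0 j) * b ^ j := by
    have h2 : a ∣ ∑ i ∈ Finset.range n, ∑ j ∈ Finset.range p,
        MvPolynomial.expand p (s (i + 1) j) * a ^ (i + 1) * b ^ j :=
      Finset.dvd_sum fun i _ => Finset.dvd_sum fun j _ =>
        ⟨MvPolynomial.expand p (s (i + 1) j) * a ^ i * b ^ j, by ring⟩
    have h3 : ∑ i ∈ Finset.range p, ∑ j ∈ Finset.range p,
        MvPolynomial.expand p (s i j) * a ^ i * b ^ j =
        ∑ i ∈ Finset.range n, ∑ j ∈ Finset.range p,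
          MvPolynomial.expand p (s (i + 1) j) * a ^ (i + 1) * b ^ j +
        ∑ j ∈ Finset.range p, MvPolynomial.expand p (s 0 j) * b ^ j := by
      conv_lhs => rw [show Finset.range p = Finset.range (n + 1) by rw [hn]]
      rw [Finset.sum_range_succ', hn]
      simp
    rw [h3] at h
    exact (dvd_add_right h2).1 h
  have h4 : ∀ j, ∃ w, j < p → s 0 j = a * w := fun j => by
    by_cases hj : j < p
    · obtain ⟨w, hw⟩ := dvd_of_dvd_expand p hap d hrel
        (dvd_of_dvd_sum_of_derivation p d' hda (fun w hw => hrel'.dvd_of_dvd_mul_left hw) p le_rfl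
          (fun j => MvPolynomial.expand p (s 0 j)) (fun j => derivation_expand p d' _) h1 j hj)
      exact ⟨w, fun _ => hw⟩
    · exact ⟨0, fun h => absurd h hj⟩
  choose w hw using h4
  -- Dividing by `a` lowers each index `i > 0` by one. For `i = 0`, `expand p (a * w j) = a *
  -- (expand p (w j) * a ^ (p - 1))`, so `w j` fills the vacant slot `n = p - 1`.
  refine ⟨fun i j => if i = n then w j else s (i + 1) j, ?_⟩
  have key : ∀ j ∈ Finset.range p, ∑ i ∈ Finset.range p,
      MvPolynomial.expand p (s i j) * a ^ i * b ^ j = a * ∑ i ∈ Finset.range p,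
        MvPolynomial.expand p (if i = n then w j else s (i + 1) j) * a ^ i * b ^ j := by
    intro j hj
    have hj' := hw j (Finset.mem_range.1 hj)
    rw [show Finset.range p = Finset.range (n + 1) by rw [hn], Finset.sum_range_succ',
      Finset.sum_range_succ, mul_add, Finset.mul_sum, hj', map_mul, hap, if_pos rfl]
    congr 1
    · refine Finset.sum_congr rfl fun i hi => ?_
      rw [if_neg (Finset.mem_range.1 hi).ne]; ring
    · rw [show a ^ p = a ^ (n + 1) by rw [hn]]; ring
  rw [Finset.sum_comm, Finset.sum_congr rfl key, ← Finset.mul_sum, Finset.sum_comm]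

end General

variable (k : Type*) [Field k] (D : Params) (p : ℕ)

/-- The inclusion `k[x₁, x₂, x₃] ⊆ k[x₁, x₂, x₃, y, z]`. -/
noncomputable def embed : Poly k →ₐ[k] MvPolynomial (Fin 5) k :=
  MvPolynomial.rename (Fin.castAdd 2)

theorem relIdeal_eq : relIdeal k D p = Ideal.span {MvPolynomial.X 3 ^ p - embed k (f k D),
    MvPolynomial.X 4 ^ p - embed k (g k D)} := rfl

/-- Modulo `(y ^ p - f, z ^ p - g)`, every polynomial is of the form `∑ s i j y ^ i z ^ j` with
`i, j < p` and `s i j ∈ k[x₁, x₂, x₃]`. -/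
theorem exists_sum_eq_mk [hp : Fact p.Prime] (P : MvPolynomial (Fin 5) k) :
    ∃ s : ℕ → ℕ → Poly k, P - ∑ i ∈ Finset.range p, ∑ j ∈ Finset.range p,
      embed k (s i j) * MvPolynomial.X 3 ^ i * MvPolynomial.X 4 ^ j ∈
        relIdeal k D p := by
  let π := Ideal.Quotient.mk (relIdeal k D p)
  let ρ : Poly k →+* (MvPolynomial (Fin 5) k ⧸ relIdeal k D p) :=
    π.comp (embed k).toRingHom
  set y := π (MvPolynomial.X 3) with hy
  set z := π (MvPolynomial.X 4) with hz
  have hyp : y ^ p = ρ (f k D) := by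
    rw [hy, ← map_pow]
    exact Ideal.Quotient.eq.2 (by rw [relIdeal_eq]; exact Ideal.subset_span (by simp))
  have hzp : z ^ p = ρ (g k D) := by
    rw [hz, ← map_pow]
    exact Ideal.Quotient.eq.2 (by rw [relIdeal_eq]; exact Ideal.subset_span (by simp))
  suffices H : ∃ s : ℕ → ℕ → Poly k, π P = ∑ i ∈ Finset.range p, ∑ j ∈ Finset.range p,
      ρ (s i j) * y ^ i * z ^ j by
    obtain ⟨s, hs⟩ := H
    refine ⟨s, Ideal.Quotient.eq.1 ?_⟩
    rw [map_sum]
    simp only [map_sum, map_mul, map_pow]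
    exact hs
  have hp0 := hp.out.pos
  induction P using MvPolynomial.induction_on with
  | C c =>
    refine ⟨fun i j => if i = 0 ∧ j = 0 then MvPolynomial.C c else 0, ?_⟩
    rw [Finset.sum_eq_single_of_mem 0 (by simpa using hp0),
      Finset.sum_eq_single_of_mem 0 (by simpa using hp0)]
    · simp [ρ]
    · intro j _ hj; simp [hj]
    · intro i _ hi; simp [hi]
  | add a b ha hb =>
    obtain ⟨s, hs⟩ := ha
    obtain ⟨s', hs'⟩ := hb
    refine ⟨fun i j => s i j + s' i j, ?_⟩
    rw [map_add, hs, hs', ← Finset.sum_add_distrib]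
    refine Finset.sum_congr rfl fun i _ => ?_
    rw [← Finset.sum_add_distrib]
    refine Finset.sum_congr rfl fun j _ => ?_
    rw [map_add]; ring
  | mul_X a n ha =>
    obtain ⟨s, hs⟩ := ha
    have hx : ∀ i : Fin 3, n = Fin.castAdd 2 i → ∃ s : ℕ → ℕ → Poly k, π (a * MvPolynomial.X n) =
        ∑ i ∈ Finset.range p, ∑ j ∈ Finset.range p, ρ (s i j) * y ^ i * z ^ j := by
      rintro i rfl
      refine ⟨fun i' j => s i' j * MvPolynomial.X i, ?_⟩
      have : ρ (MvPolynomial.X i) = π (MvPolynomial.X (Fin.castAdd 2 i)) := by simp [ρ, embed]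
      rw [map_mul, hs, Finset.sum_mul]
      refine Finset.sum_congr rfl fun i' _ => ?_
      rw [Finset.sum_mul]
      refine Finset.sum_congr rfl fun j _ => ?_
      rw [map_mul, this]; ring
    have hyy : ∃ s' : ℕ → ℕ → Poly k, π a * y =
        ∑ i ∈ Finset.range p, ∑ j ∈ Finset.range p, ρ (s' i j) * y ^ i * z ^ j := by
      refine ⟨fun i j => if i = 0 then f k D * s (p - 1) j else s (i - 1) j, ?_⟩
      rw [hs, Finset.sum_comm, Finset.sum_mul]
      conv_rhs => rw [Finset.sum_comm]
      refine Finset.sum_congr rfl fun j _ => ?_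
      have h1 := mul_sum_mul_pow p hp0 (fun i => ρ (s i j) * z ^ j) y
      calc _ = (∑ i ∈ Finset.range p, ρ (s i j) * z ^ j * y ^ i) * y := by
            congr 1; exact Finset.sum_congr rfl fun i _ => by ring
        _ = _ := by
            rw [h1]
            refine Finset.sum_congr rfl fun i _ => ?_
            dsimp only
            split_ifs
            · rw [map_mul, hyp]; ring
            · ring
    have hzz : ∃ s' : ℕ → ℕ → Poly k, π a * z =
        ∑ i ∈ Finset.range p, ∑ j ∈ Finset.range p, ρ (s' i j) * y ^ i * z ^ j := by
      refine ⟨fun i j => if j = 0 then g k D * s i (p - 1) else s i (j - 1), ?_⟩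
      rw [hs, Finset.sum_mul]
      refine Finset.sum_congr rfl fun i _ => ?_
      rw [mul_sum_mul_pow p hp0 (fun j => ρ (s i j) * y ^ i) z]
      refine Finset.sum_congr rfl fun j _ => ?_
      dsimp only
      split_ifs
      · rw [map_mul, hzp]; ring
      · ring
    rw [map_mul]
    rw [map_mul] at hx
    fin_cases n
    · exact hx 0 rfl
    · exact hx 1 rfl
    · exact hx 2 rfl
    · exact hyy
    · exact hzz

/-- The homomorphism `k[x₁, x₂, x₃, y, z] → k[x₁, x₂, x₃]` with `xᵢ ↦ xᵢ ^ p`, `y ↦ f`,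
`z ↦ g`. -/
noncomputable def powHom : MvPolynomial (Fin 5) k →ₐ[k] Poly k :=
  MvPolynomial.aeval ![MvPolynomial.X 0 ^ p, MvPolynomial.X 1 ^ p, MvPolynomial.X 2 ^ p,
    f k D, g k D]

theorem powHom_embed (s : Poly k) :
    powHom k D p (embed k s) = MvPolynomial.expand p s := by
  have : (powHom k D p).comp (embed k) =
      MvPolynomial.expand (σ := Fin 3) (R := k) p := by
    ext i : 1
    fin_cases i <;> simp [powHom, embed, Fin.castAdd, Fin.castLE]
  exact DFunLike.congr_fun this s

theorem powHom_X_three : powHom k D p (MvPolynomial.X 3) = f k D := by simp [powHom]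

theorem powHom_X_four : powHom k D p (MvPolynomial.X 4) = g k D := by simp [powHom]

theorem powHom_sum (s : ℕ → ℕ → Poly k) :
    powHom k D p (∑ i ∈ Finset.range p, ∑ j ∈ Finset.range p,
      embed k (s i j) * MvPolynomial.X 3 ^ i *
        MvPolynomial.X 4 ^ j) =
    ∑ i ∈ Finset.range p, ∑ j ∈ Finset.range p,
      MvPolynomial.expand p (s i j) * f k D ^ i * g k D ^ j := by
  simp only [map_sum, map_mul, map_pow, powHom_embed, powHom_X_three, powHom_X_four]

variable [hp : Fact p.Prime] [CharP k p]

theorem powHom_eq_zero_of_mem {P : MvPolynomial (Fin 5) k} (hP : P ∈ relIdeal k D p) :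
    powHom k D p P = 0 := by
  have : relIdeal k D p ≤ RingHom.ker (powHom k D p) := by
    rw [relIdeal_eq, Ideal.span_le]
    rintro x (rfl | rfl)
    · simp [RingHom.mem_ker, powHom_embed, powHom_X_three, expand_f]
    · simp [RingHom.mem_ker, powHom_embed, powHom_X_four, expand_g]
  exact this hP

theorem exists_powHom_eq_sum (P : MvPolynomial (Fin 5) k) :
    ∃ s : ℕ → ℕ → Poly k, powHom k D p P = ∑ i ∈ Finset.range p, ∑ j ∈ Finset.range p,
      MvPolynomial.expand p (s i j) * f k D ^ i * g k D ^ j := by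
  obtain ⟨s, hs⟩ := exists_sum_eq_mk k D p P
  refine ⟨s, ?_⟩
  rw [← powHom_sum, ← sub_eq_zero, ← map_sub]
  exact powHom_eq_zero_of_mem k D p hs

theorem isRelPrime_pderiv_two_f : IsRelPrime (f k D) (MvPolynomial.pderiv 2 (f k D)) := by
  rw [pderiv_two_f]; exact (isRelPrime_X_f k D).symm

/-- Division by f stays inside k[x^p, f, g]. Here ∂f/∂x₃ = x₁ is coprime to f, and `derivF`
separates the powers of g modulo f. -/
theorem exists_powHom_eq_f_mul (hpmt : ¬ p ∣ D.m * D.t - 1) (P : MvPolynomial (Fin 5) k)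
    (h : f k D ∣ powHom k D p P) : ∃ P', powHom k D p P = f k D * powHom k D p P' := by
  obtain ⟨s, hs⟩ := exists_powHom_eq_sum k D p P
  rw [hs] at h
  obtain ⟨s', hs'⟩ := exists_eq_mul_sum_expand p (expand_f k D p) (MvPolynomial.pderiv 2)
    (derivF k) (isRelPrime_pderiv_two_f k D) (derivF_f k D) (isRelPrime_derivF_g k D p hpmt) s h
  exact ⟨_, (hs.trans hs').trans (congrArg (f k D * ·) (powHom_sum k D p s').symm)⟩

/-- The same with f and g exchanged: `derivXF` has a value at g coprime to g, and `derivXG` kills g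
and takes that same value at f. -/
theorem exists_powHom_eq_g_mul (hpt : ¬ p ∣ D.t) (P : MvPolynomial (Fin 5) k)
    (h : g k D ∣ powHom k D p P) : ∃ P', powHom k D p P = g k D * powHom k D p P' := by
  obtain ⟨s, hs⟩ := exists_powHom_eq_sum k D p P
  have hsw : ∀ s : ℕ → ℕ → Poly k, ∑ i ∈ Finset.range p, ∑ j ∈ Finset.range p,
      MvPolynomial.expand p (s i j) * f k D ^ i * g k D ^ j =
      ∑ i ∈ Finset.range p, ∑ j ∈ Finset.range p,
      MvPolynomial.expand p (s j i) * g k D ^ i * f k D ^ j := fun s => by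
    rw [Finset.sum_comm]
    exact Finset.sum_congr rfl fun i _ => Finset.sum_congr rfl fun j _ => by ring
  rw [hs, hsw] at h
  obtain ⟨s', hs'⟩ := exists_eq_mul_sum_expand p (expand_g k D p) (derivXF k D)
    (derivXG k D) (isRelPrime_derivXF_g k D p hpt) (derivXG_g k D)
    (by rw [derivXG_f]; exact isRelPrime_derivXF_g k D p hpt) (fun i j => s j i) h
  rw [← hsw fun i j => s' j i] at hs'
  exact ⟨_, ((hs.trans (hsw s)).trans hs').trans (congrArg (g k D * ·) (powHom_sum k D p _).symm)⟩

/-- The kernel of `powHom` is `(y ^ p - f, z ^ p - g)`. -/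
theorem ker_powHom (hpt : ¬ p ∣ D.t) : RingHom.ker (powHom k D p) = relIdeal k D p := by
  refine le_antisymm (fun P hP => ?_) fun P hP => powHom_eq_zero_of_mem k D p hP
  obtain ⟨s, hs⟩ := exists_sum_eq_mk k D p P
  have h0 := powHom_eq_zero_of_mem k D p hs
  rw [map_sub, RingHom.mem_ker.1 hP, zero_sub, neg_eq_zero, powHom_sum] at h0
  have hne := derivXF_g_ne_zero k D p hpt
  -- Independence modulo `a`, taken at `a = 0`, is linear independence: `derivXG` kills the
  -- coefficients, including g, and separates the powers of f. Afterwards `derivXF` separates the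
  -- powers of g.
  have h1 : ∀ i < p, ∑ j ∈ Finset.range p, MvPolynomial.expand p (s i j) * g k D ^ j = 0 := by
    intro i hi
    rw [← zero_dvd_iff]
    refine dvd_of_dvd_sum_of_derivation p (derivXG k D) (map_zero _) (b := f k D) ?_ p le_rfl
      (fun i => ∑ j ∈ Finset.range p, MvPolynomial.expand p (s i j) * g k D ^ j) ?_ ?_ i hi
    · intro w hw
      rw [zero_dvd_iff, derivXG_f] at hw
      rw [(mul_eq_zero.1 hw).resolve_left hne]
    · intro i
      simp [Derivation.leibniz, Derivation.leibniz_pow, derivation_expand, derivXG_g]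
    · rw [zero_dvd_iff, ← h0]
      refine Finset.sum_congr rfl fun i _ => ?_
      rw [Finset.sum_mul]
      exact Finset.sum_congr rfl fun j _ => by ring
  have h2 : ∀ i < p, ∀ j < p, s i j = 0 := by
    intro i hi j hj
    rw [← MvPolynomial.expand_eq_zero hp.out.pos, ← zero_dvd_iff]
    refine dvd_of_dvd_sum_of_derivation p (derivXF k D) (map_zero _) (b := g k D) ?_ p le_rfl
      (fun j => MvPolynomial.expand p (s i j)) (fun j => derivation_expand p _ _) ?_ j hj
    · intro w hw
      rw [zero_dvd_iff] at hw
      rw [(mul_eq_zero.1 hw).resolve_left hne]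
    · rw [h1 i hi]
  rw [Finset.sum_eq_zero, sub_zero] at hs
  · exact hs
  · intro i hi
    refine Finset.sum_eq_zero fun j hj => ?_
    rw [h2 i (Finset.mem_range.1 hi) j (Finset.mem_range.1 hj)]
    simp

end RankThree

/-! ### The elements ψ(xᵢ^p) are polynomials -/

namespace RankThree

variable (k : Type*) [Field k] (D : Params) (p : ℕ)

theorem not_isUnit_f : ¬ IsUnit (f k D) := by
  intro h
  have h3 := h.map (MvPolynomial.eval ![0, 0, 0])
  have ht : D.t ≠ 0 := by have := D.two_le_t; omega
  simp [f, ht] at h3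

theorem rp_mem_Crp : toFrac k (r k D) ^ p ∈ Crp k D p := Algebra.subset_adjoin rfl

/-- `r ^ p` as an element of `C[r ^ p]`. -/
noncomputable def rpCrp : Crp k D p := ⟨toFrac k (r k D) ^ p, rp_mem_Crp k D p⟩

variable [hp : Fact p.Prime] (h : Poly k)

theorem psiFrac_rpCrp : psiFrac k D p h (rpCrp k D p) = toFrac k (q k D p h) := by
  have := subst_gen ((transcendental_r k D).pow hp.out.pos) (Crp k D p) rfl
    (⟨toFrac k (q k D p h), Algebra.subset_adjoin rfl⟩ : Cq k D p h) (rp_mem_Crp k D p)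
  exact congrArg Subtype.val this

theorem psiFrac_fCrp : psiFrac k D p h (fCrp k D p) = toFrac k (f k D) :=
  congrArg Subtype.val ((psi k D p h).commutes ⟨_, f_mem_C k D⟩)

theorem psiFrac_gCrp : psiFrac k D p h (gCrp k D p) = toFrac k (g k D) :=
  congrArg Subtype.val ((psi k D p h).commutes ⟨_, g_mem_C k D⟩)

variable [CharP k p]

/-- The three relations hold for the xᵢ^p with r^p in place of q, and ψ carries r^p to q. They
determine their solution successively, by cancelling g^p, f^(lp) and `y 0`. -/
theorem psiFrac_xPow {y : Fin 3 → Poly k}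
    (hy0 : g k D ^ p * y 0 = (f k D ^ p) ^ (D.l * D.t + 1) + q k D p h ^ D.t)
    (hy1 : (f k D ^ D.l) ^ p * y 1 + y 0 ^ D.m = q k D p h)
    (hy2 : y 0 * y 2 = f k D ^ p + y 1 ^ D.t) (hy : y 0 ≠ 0) (i : Fin 3) :
    psiFrac k D p h (xPow k D p i) = toFrac k (y i) := by
  have hchar : CharP (Frac k) p :=
    charP_of_injective_algebraMap (algebraMap k (Frac k)).injective p
  have E0 : gCrp k D p ^ p * xPow k D p 0 =
      (fCrp k D p ^ p) ^ (D.l * D.t + 1) + rpCrp k D p ^ D.t := by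
    apply Subtype.ext
    change toFrac k (g k D) ^ p * toFrac k (MvPolynomial.X 0) ^ p =
      (toFrac k (f k D) ^ p) ^ (D.l * D.t + 1) + (toFrac k (r k D) ^ p) ^ D.t
    rw [← mul_pow, ← map_mul, mul_comm (g k D), X_mul_g, map_add, map_pow, map_pow, add_pow_char]
    ring
  have E1 : (fCrp k D p ^ D.l) ^ p * xPow k D p 1 + xPow k D p 0 ^ D.m = rpCrp k D p := by
    apply Subtype.ext
    change (toFrac k (f k D) ^ D.l) ^ p * toFrac k (MvPolynomial.X 1) ^ p +
      (toFrac k (MvPolynomial.X 0) ^ p) ^ D.m = toFrac k (r k D) ^ p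
    rw [r, map_add, map_mul, map_pow, map_pow, add_pow_char]
    ring
  have E2 : xPow k D p 0 * xPow k D p 2 = fCrp k D p ^ p + xPow k D p 1 ^ D.t := by
    apply Subtype.ext
    change toFrac k (MvPolynomial.X 0) ^ p * toFrac k (MvPolynomial.X 2) ^ p =
      toFrac k (f k D) ^ p + (toFrac k (MvPolynomial.X 1) ^ p) ^ D.t
    rw [f, map_sub, map_mul, map_pow, sub_pow_char]
    ring
  have F0 := congrArg (psiFrac k D p h) E0
  have F1 := congrArg (psiFrac k D p h) E1
  have F2 := congrArg (psiFrac k D p h) E2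
  simp only [map_add, map_mul, map_pow, psiFrac_rpCrp, psiFrac_fCrp, psiFrac_gCrp] at F0 F1 F2
  replace hy0 := congrArg (toFrac k) hy0
  replace hy1 := congrArg (toFrac k) hy1
  replace hy2 := congrArg (toFrac k) hy2
  simp only [map_add, map_mul, map_pow] at hy0 hy1 hy2
  have G0 : psiFrac k D p h (xPow k D p 0) = toFrac k (y 0) :=
    mul_left_cancel₀ (pow_ne_zero p (tg_ne_zero k D)) (F0.trans hy0.symm)
  have G1 : psiFrac k D p h (xPow k D p 1) = toFrac k (y 1) := by
    rw [G0] at F1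
    exact mul_left_cancel₀ (pow_ne_zero p (pow_ne_zero D.l (tf_ne_zero k D)))
      (add_right_cancel (F1.trans hy1.symm))
  have G2 : psiFrac k D p h (xPow k D p 2) = toFrac k (y 2) := by
    rw [G0, G1] at F2
    exact mul_left_cancel₀ ((map_ne_zero_iff _ (toFrac_injective k)).2 hy) (F2.trans hy2.symm)
  fin_cases i
  · exact G0
  · exact G1
  · exact G2

/-- If `f ^ (l + 1) g ^ 2` divides `h ^ (p - 1)`, there are polynomials `y₁, y₂, y₃`, congruent to
`x₁ ^ p, x₂ ^ p, x₃ ^ p` modulo `f g`, which satisfy the relations of `ψ(xᵢ ^ p)`. -/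
theorem exists_psi_X_pow {u : Poly k}
    (hu : h ^ (p - 1) = f k D ^ (D.l + 1) * g k D ^ 2 * u) :
    ∃ y : Fin 3 → Poly k, (∀ i, f k D * g k D ∣ y i - MvPolynomial.X i ^ p) ∧
      g k D ^ p * y 0 = (f k D ^ p) ^ (D.l * D.t + 1) + q k D p h ^ D.t ∧
      (f k D ^ D.l) ^ p * y 1 + y 0 ^ D.m = q k D p h ∧
      y 0 * y 2 = f k D ^ p + y 1 ^ D.t ∧ y 0 ≠ 0 := by
  have hl := D.one_le_l
  have hm := D.one_le_m
  have hp1 : p - 1 + 1 = p := Nat.sub_add_cancel hp.out.one_le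
  set F := f k D with hF
  set G := g k D with hG
  set R := r k D with hR
  set Q := q k D p h with hQ
  set x0 : Poly k := MvPolynomial.X 0 with hx0
  set x1 : Poly k := MvPolynomial.X 1 with hx1
  set x2 : Poly k := MvPolynomial.X 2 with hx2
  -- The hypothesis on h makes q - r^p divisible by f^(lp+1) g^(p+1). The divisions by g^p for `y0`
  -- and by f^(lp) for `y1` still leave a factor f g, whence the congruences.
  have hQ' : Q = R ^ p + F * (F ^ D.l) ^ p * G * G ^ p * (-u * R) := by
    have h1 : (F ^ D.l) ^ p = (F ^ D.l) ^ (p - 1) * F ^ D.l := by rw [← pow_succ, hp1]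
    have h2 : G ^ p = G ^ (p - 1) * G := by rw [← pow_succ, hp1]
    rw [hQ, q, mul_pow, mul_pow, hu, h1, h2]
    ring
  have e0 : x0 ^ p * G ^ p = (F ^ p) ^ (D.l * D.t + 1) + (R ^ p) ^ D.t := by
    rw [← mul_pow, X_mul_g, add_pow_char]; ring
  have e1 : R ^ p = (F ^ D.l) ^ p * x1 ^ p + (x0 ^ p) ^ D.m := by
    rw [hR, r, add_pow_char]; ring
  have e2 : x0 ^ p * x2 ^ p = F ^ p + (x1 ^ p) ^ D.t := by
    rw [hF, f, sub_pow_char]; ring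
  obtain ⟨S, hS⟩ := sub_dvd_pow_sub_pow Q (R ^ p) D.t
  set y0 := x0 ^ p + F * (F ^ D.l) ^ p * G * ((-u * R) * S) with hy0
  have E0 : G ^ p * y0 = (F ^ p) ^ (D.l * D.t + 1) + Q ^ D.t := by
    have : Q - R ^ p = F * (F ^ D.l) ^ p * G * G ^ p * (-u * R) := by rw [hQ']; ring
    rw [this] at hS
    rw [hy0]
    linear_combination e0 - hS
  obtain ⟨S', hS'⟩ := sub_dvd_pow_sub_pow y0 (x0 ^ p) D.m
  set y1 := x1 ^ p + F * G * (G ^ p * (-u * R) - (-u * R) * S * S') with hy1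
  have E1 : (F ^ D.l) ^ p * y1 + y0 ^ D.m = Q := by
    have : y0 - x0 ^ p = F * (F ^ D.l) ^ p * G * ((-u * R) * S) := by rw [hy0]; ring
    rw [this] at hS'
    rw [hy1, hQ']
    linear_combination hS' - e1
  have hrel : IsRelPrime F y0 := by
    have h1 : IsRelPrime F (x0 ^ p) := (isRelPrime_X_f k D).symm.pow_right
    have h2 : x0 ^ p = y0 + F * (-((F ^ D.l) ^ p * G * ((-u * R) * S))) := by rw [hy0]; ring
    rw [h2] at h1
    exact h1.of_add_mul_left_right
  have hy00 : y0 ≠ 0 := by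
    intro h0
    rw [h0, isRelPrime_zero_right] at hrel
    exact not_isUnit_f k D hrel
  -- `Y` imitates the defining formula of g and should be f^(lpt) `y2`. The divisibility holds for
  -- `y0 * Y`, and `y0` is coprime to f.
  set Y := G ^ p - y0 ^ (D.m - 1) * ∑ i ∈ Finset.range D.t,
    Q ^ i * ((F ^ D.l) ^ p * y1) ^ (D.t - 1 - i) with hY
  have hY1 : y0 * Y = ((F ^ D.l) ^ p) ^ D.t * (F ^ p + y1 ^ D.t) := by
    have h1 := (Commute.all Q ((F ^ D.l) ^ p * y1)).geom_sum₂_mul D.t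
    have h2 : Q - (F ^ D.l) ^ p * y1 = y0 * y0 ^ (D.m - 1) := by
      rw [← pow_succ', Nat.sub_add_cancel hm, ← E1]; ring
    rw [h2] at h1
    rw [hY]
    have h3 : (F ^ p) ^ (D.l * D.t + 1) = ((F ^ D.l) ^ p) ^ D.t * F ^ p := by ring
    rw [h3] at E0
    rw [mul_pow _ y1 D.t] at h1
    linear_combination E0 - h1
  obtain ⟨y2, hy2⟩ : ((F ^ D.l) ^ p) ^ D.t ∣ Y := by
    refine IsRelPrime.dvd_of_dvd_mul_left (y := y0) ?_ ⟨_, hY1⟩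
    exact ((hrel.pow_left).pow_left).pow_left
  have E2 : y0 * y2 = F ^ p + y1 ^ D.t := by
    apply mul_left_cancel₀ (pow_ne_zero D.t (pow_ne_zero p (pow_ne_zero D.l (f_ne_zero k D))))
    rw [← hY1, hy2]; ring
  have d0 : F * G ∣ y0 - x0 ^ p := ⟨(F ^ D.l) ^ p * ((-u * R) * S), by rw [hy0]; ring⟩
  have d1 : F * G ∣ y1 - x1 ^ p := ⟨G ^ p * (-u * R) - (-u * R) * S * S', by rw [hy1]; ring⟩
  refine ⟨![y0, y1, y2], ?_, E0, E1, E2, hy00⟩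
  intro i
  fin_cases i
  · exact d0
  · exact d1
  -- Comparing `E2` with `e2` shows that f g divides `x0 ^ p * (y2 - x2 ^ p)`; the factor `x0 ^ p`
  -- is coprime to f g.
  · have h1 : IsRelPrime (F * G) (x0 ^ p) :=
      ((isRelPrime_X_f k D).symm.mul_left (isRelPrime_X_g k D).symm).pow_right
    refine h1.dvd_of_dvd_mul_left ?_
    obtain ⟨c, hc⟩ := d0
    obtain ⟨c', hc'⟩ := d1.trans (sub_dvd_pow_sub_pow y1 (x1 ^ p) D.t)
    refine ⟨c' - c * y2, ?_⟩
    change x0 ^ p * (y2 - x2 ^ p) = _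
    linear_combination E2 - e2 + hc' - y2 * hc

end RankThree

/-! ### Translation-invariant polynomials, and the invariants inside C[q] -/

namespace RankThree

section General

theorem subst_injective {A K B : Type*} [CommRing A] [CommRing K] [Algebra A K]
    [CommRing B] [Algebra A B] {s : K} (hs : Transcendental A s) (S : Subalgebra A K)
    (hS : S = Algebra.adjoin A {s}) {b : B} (hb : Transcendental A b) :
    Function.Injective (subst hs S hS b) := by
  have := transcendental_iff_injective.1 hb
  exact (this.comp (AlgEquiv.injective
    (Polynomial.algEquivOfTranscendental A s hs).symm)).comp
      (AlgEquiv.injective (Subalgebra.equivOfEq S _ hS))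

open Polynomial in
theorem artinSchreier_monic {A : Type*} [CommRing A] (p : ℕ) [hp : Fact p.Prime] (c : A) :
    (X ^ p - Polynomial.C c * X : A[X]).Monic := by
  refine monic_X_pow_sub (p := Polynomial.C c * X) ?_
  refine (degree_C_mul_X_le c).trans_lt ?_
  exact_mod_cast hp.out.one_lt

open Polynomial in
theorem artinSchreier_natDegree {A : Type*} [CommRing A] [Nontrivial A] (p : ℕ)
    [hp : Fact p.Prime] (c : A) : (X ^ p - Polynomial.C c * X : A[X]).natDegree = p := by
  refine natDegree_eq_of_degree_eq_some ?_
  rw [degree_sub_eq_left_of_degree_lt] <;> rw [degree_X_pow]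
  refine (degree_C_mul_X_le c).trans_lt ?_
  exact_mod_cast hp.out.one_lt

open Polynomial in
theorem artinSchreier_comp {A : Type*} [CommRing A] (p : ℕ) [hp : Fact p.Prime] [CharP A p]
    (a : A) : (X ^ p - Polynomial.C (a ^ (p - 1)) * X : A[X]).comp (X + Polynomial.C a) =
    X ^ p - Polynomial.C (a ^ (p - 1)) * X := by
  have h : Polynomial.C a ^ p = Polynomial.C (a ^ (p - 1)) * Polynomial.C a := by
    rw [C_pow, ← pow_succ, Nat.sub_add_cancel hp.out.one_le]
  simp only [sub_comp, pow_comp, X_comp, mul_comp, C_comp]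
  rw [add_pow_char, h]; ring

open Polynomial in
-- Such a polynomial takes one value at the p distinct points 0, a, …, (p - 1) a, more points than
-- its degree allows unless it is constant.
theorem eq_C_of_comp_X_add_C_eq {A : Type*} [CommRing A] [IsDomain A] (p : ℕ) [CharP A p]
    {a : A} (ha : a ≠ 0) {w : A[X]} (hdeg : w.natDegree < p)
    (hw : w.comp (X + Polynomial.C a) = w) : w = Polynomial.C (w.eval 0) := by
  have heval : ∀ n : ℕ, w.eval ((n : A) * a) = w.eval 0 := by
    intro n
    induction n with
    | zero => simp
    | succ n ih =>
      rw [← ih]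
      conv_rhs => rw [← hw]
      simp [add_mul]
  rw [← sub_eq_zero]
  refine eq_zero_of_natDegree_lt_card_of_eval_eq_zero _
    (f := fun i : Fin p => ((i : ℕ) : A) * a) ?_ ?_ ?_
  · intro i j hij
    exact Fin.ext (CharP.natCast_injOn_Iio A p i.2 j.2 (mul_right_cancel₀ ha hij))
  · intro i; simp [heval]
  · rw [Fintype.card_fin, natDegree_sub_C]; exact hdeg

open Polynomial in
/-- In characteristic `p`, a polynomial invariant under `X ↦ X + a`, where `a ≠ 0`, is a
polynomial in `X ^ p - a ^ (p - 1) X`. -/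
theorem exists_eq_comp_of_comp_X_add_C_eq {A : Type*} [CommRing A] [IsDomain A] (p : ℕ)
    [hp : Fact p.Prime] [CharP A p] {a : A} (ha : a ≠ 0) (u : A[X])
    (hu : u.comp (X + Polynomial.C a) = u) :
    ∃ v : A[X], u = v.comp (X ^ p - Polynomial.C (a ^ (p - 1)) * X) := by
  obtain ⟨n, hn⟩ : ∃ n, u.natDegree = n := ⟨_, rfl⟩
  induction n using Nat.strong_induction_on generalizing u with
  | _ n ih =>
    rcases lt_or_ge u.natDegree p with hlt | hge
    · exact ⟨Polynomial.C (u.eval 0), by rw [C_comp]; exact eq_C_of_comp_X_add_C_eq p ha hlt hu⟩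
    set Q : A[X] := X ^ p - Polynomial.C (a ^ (p - 1)) * X with hQ
    have hQm : Q.Monic := artinSchreier_monic p _
    have hQd : Q.natDegree = p := artinSchreier_natDegree p _
    have hQ1 : Q ≠ 1 := by
      intro h; rw [h, natDegree_one] at hQd; exact hp.out.ne_zero hQd.symm
    have hdm := modByMonic_add_div u Q
    -- The translation fixes `Q`, so by uniqueness of division the quotient and the remainder of `u`
    -- are both invariant. The remainder is then constant, and induction applies to the quotient.
    have hdm' : (u %ₘ Q).comp (X + Polynomial.C a) + Q * (u /ₘ Q).comp (X + Polynomial.C a) =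
        u := by
      have h1 := congrArg (fun v => v.comp (X + Polynomial.C a)) hdm
      simp only [add_comp, mul_comp] at h1
      rw [artinSchreier_comp, hu] at h1
      exact h1
    have hdeg : ((u %ₘ Q).comp (X + Polynomial.C a)).degree < Q.degree := by
      rw [← taylor_apply, degree_taylor]
      exact degree_modByMonic_lt _ hQm
    obtain ⟨h1, h2⟩ := div_modByMonic_unique _ _ hQm ⟨hdm', hdeg⟩
    obtain ⟨v, hv⟩ := ih (u /ₘ Q).natDegree (by
      rw [natDegree_divByMonic _ hQm, hQd]; have := hp.out.pos; omega) _ h1.symm rfl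
    have h3 := eq_C_of_comp_X_add_C_eq p ha
      (by rw [← hQd]; exact natDegree_modByMonic_lt _ hQm hQ1) h2.symm
    refine ⟨Polynomial.C ((u %ₘ Q).eval 0) + X * v, ?_⟩
    rw [add_comp, mul_comp, C_comp, X_comp, ← hv, ← h3]
    exact hdm.symm

end General

variable (k : Type*) [Field k] (D : Params)

/-- `r` as an element of `C[r]`. -/
noncomputable def rCr : Cr k D := ⟨toFrac k (r k D), r_mem_Cr k D⟩

theorem exists_aeval_rCr (z : Cr k D) :
    ∃ u : Polynomial (C k D), Polynomial.aeval (rCr k D) u = z := by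
  obtain ⟨z, hz⟩ := z
  have hz' := hz
  rw [Cr, Algebra.adjoin_singleton_eq_range_aeval] at hz'
  obtain ⟨u, rfl⟩ := hz'
  refine ⟨u, Subtype.ext ?_⟩
  exact (Polynomial.aeval_algHom_apply (Cr k D).val (rCr k D) u).symm

theorem aeval_rCr_injective : Function.Injective (Polynomial.aeval (R := C k D) (rCr k D)) := by
  intro u v huv
  apply transcendental_iff_injective.1 (transcendental_r k D)
  have h := congrArg (Cr k D).val huv
  rwa [← Polynomial.aeval_algHom_apply, ← Polynomial.aeval_algHom_apply] at h

/-- This turns statements about ε̃ into statements about polynomials in r over C, on which setting T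
= z is a translation. -/
theorem eval_epsilonTilde_aeval (z : Cr k D) (u : Polynomial (C k D)) :
    Polynomial.eval z (epsilonTilde k D (Polynomial.aeval (rCr k D) u)) =
      Polynomial.aeval (rCr k D + incl k D (f k D ^ D.l * g k D) * z) u := by
  have h1 : epsilonTilde k D (rCr k D) = Polynomial.C (rCr k D) +
      Polynomial.C (incl k D (f k D ^ D.l * g k D)) * Polynomial.X := epsilonTilde_r k D
  rw [← Polynomial.aeval_algHom_apply, h1]
  rw [Polynomial.aeval_def, Polynomial.aeval_def, ← Polynomial.coe_evalRingHom,
    Polynomial.hom_eval₂]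
  congr 1
  · exact RingHom.ext fun c => Polynomial.eval_C
  · rw [Polynomial.coe_evalRingHom, Polynomial.eval_add, Polynomial.eval_mul, Polynomial.eval_C,
      Polynomial.eval_C, Polynomial.eval_X]

theorem incl_epsilonAt (h b : Poly k) : incl k D (epsilonAt k D h b) =
    Polynomial.eval (incl k D h) (epsilonTilde k D (incl k D b)) := by
  rw [← inclT_epsilon]
  change incl k D (Polynomial.aeval h (epsilon k D b)) =
    Polynomial.eval (incl k D h) ((epsilon k D b).map (incl k D).toRingHom)
  rw [Polynomial.eval_map, Polynomial.aeval_def]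
  change (incl k D).toRingHom _ = _
  rw [Polynomial.hom_eval₂]
  rfl

theorem coe_algebraMap_Cr (c : C k D) : (algebraMap (C k D) (Cr k D) c : Frac k) = c :=
  (Cr k D).val.commutes c

theorem coe_incl (a : Poly k) : (incl k D a : Frac k) = toFrac k a := rfl

theorem exists_incl_mul_eq_one :
    ∃ c : C k D, incl k D (f k D ^ D.l * g k D) * algebraMap (C k D) (Cr k D) c = 1 := by
  have hf := tf_ne_zero k D
  have hg := tg_ne_zero k D
  refine ⟨⟨(toFrac k (f k D))⁻¹ ^ D.l * (toFrac k (g k D))⁻¹,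
    mul_mem (pow_mem (f_inv_mem_C k D) _) (g_inv_mem_C k D)⟩, ?_⟩
  apply Subtype.val_injective
  rw [MulMemClass.coe_mul, coe_algebraMap_Cr, coe_incl, OneMemClass.coe_one, map_mul, map_pow]
  change _ * ((toFrac k (f k D))⁻¹ ^ D.l * (toFrac k (g k D))⁻¹) = 1
  rw [inv_pow]
  field_simp

/-- The elements of `k[x₁, x₂, x₃]` invariant under `ε` belong to `C`. -/
theorem toFrac_mem_C_of_mem_epsilonInvariants {h : Poly k} (hinv : h ∈ epsilonInvariants k D) :
    toFrac k h ∈ C k D := by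
  have h1 : epsilonTilde k D (incl k D h) = Polynomial.C (incl k D h) := by
    rw [← inclT_epsilon, show epsilon k D h = Polynomial.C h from hinv, inclT_C]
  obtain ⟨u, hu⟩ := exists_aeval_rCr k D (incl k D h)
  obtain ⟨c, hc⟩ := exists_incl_mul_eq_one k D
  -- The value T = -r / (f^l g) moves r to 0, so the invariant element u(r) equals u(0), which lies
  -- in C.
  have h2 := eval_epsilonTilde_aeval k D (- (algebraMap (C k D) (Cr k D) c * rCr k D)) u
  rw [hu, h1, Polynomial.eval_C, mul_neg, ← mul_assoc, hc, one_mul, add_neg_cancel,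
    ← Polynomial.coeff_zero_eq_aeval_zero'] at h2
  have h3 := congrArg Subtype.val h2
  rw [coe_algebraMap_Cr, coe_incl] at h3
  rw [h3]
  exact (u.coeff 0).2

/-- The element `f ^ l g h` of `C`. -/
noncomputable def translation {h : Poly k} (hh : toFrac k h ∈ C k D) : C k D :=
  ⟨toFrac k (f k D ^ D.l * g k D * h), by
    rw [map_mul, map_mul, map_pow]
    exact mul_mem (mul_mem (pow_mem (f_mem_C k D) _) (g_mem_C k D)) hh⟩

theorem incl_translation {h : Poly k} (hh : toFrac k h ∈ C k D) :
    incl k D (f k D ^ D.l * g k D) * incl k D h =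
      algebraMap (C k D) (Cr k D) (translation k D hh) := by
  rw [← map_mul]
  rfl

theorem translation_ne_zero {h : Poly k} (hh : toFrac k h ∈ C k D) (h0 : h ≠ 0) :
    translation k D hh ≠ 0 := by
  intro h1
  have h2 : toFrac k (f k D ^ D.l * g k D * h) = 0 := congrArg Subtype.val h1
  rw [map_eq_zero_iff _ (toFrac_injective k)] at h2
  exact mul_ne_zero (mul_ne_zero (pow_ne_zero _ (f_ne_zero k D)) (g_ne_zero k D)) h0 h2

theorem epsilonAt_of_mem (h : Poly k) {a : Poly k} (ha : toFrac k a ∈ C k D) :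
    epsilonAt k D h a = a := by
  apply incl_injective k D
  rw [incl_epsilonAt, epsilonTilde_of_mem k D a ha, inclT_C, Polynomial.eval_C]

theorem epsilonAt_r (h : Poly k) : epsilonAt k D h (r k D) = r k D + f k D ^ D.l * g k D * h := by
  apply incl_injective k D
  rw [incl_epsilonAt, epsilonTilde_r]
  simp

variable (p : ℕ)

theorem aeval_artinSchreier {h : Poly k} (hh : toFrac k h ∈ C k D) :
    Polynomial.aeval (toFrac k (r k D)) (Polynomial.X ^ p -
      Polynomial.C (translation k D hh ^ (p - 1)) * Polynomial.X) = toFrac k (q k D p h) := by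
  rw [map_sub, map_mul, map_pow, Polynomial.aeval_X, Polynomial.aeval_C, map_pow, q,
    map_sub (toFrac k), map_mul (toFrac k), map_pow (toFrac k), map_pow (toFrac k)]
  rfl

variable [hp : Fact p.Prime]

/-- q is a monic polynomial of degree p in r over C, and r is transcendental. -/
theorem transcendental_q {h : Poly k} (hh : toFrac k h ∈ C k D) :
    Transcendental (C k D) (toFrac k (q k D p h)) := by
  rw [← aeval_artinSchreier k D p hh]
  refine (transcendental_r k D).aeval _ ?_ ?_
  · rw [artinSchreier_natDegree]; exact hp.out.ne_zero
  · rw [(artinSchreier_monic p _).leadingCoeff]; exact one_mem _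

theorem psiFrac_injective {h : Poly k} (hh : toFrac k h ∈ C k D) :
    Function.Injective (psiFrac k D p h) := by
  have h1 : Transcendental (C k D)
      (⟨toFrac k (q k D p h), Algebra.subset_adjoin rfl⟩ : Cq k D p h) := fun h2 =>
    transcendental_q k D p hh (h2.algHom (Cq k D p h).val)
  have h3 := subst_injective ((transcendental_r k D).pow hp.out.pos) (Crp k D p) rfl h1
  exact Subtype.val_injective.comp h3

variable [CharP k p]

/-- An element of `k[x₁, x₂, x₃]` invariant under `ε_h` belongs to `C[q]`. -/
theorem toFrac_mem_Cq_of_mem_invariants {h : Poly k} (hinv : h ∈ epsilonInvariants k D)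
    (h0 : h ≠ 0) {b : Poly k} (hb : b ∈ invariants k (epsilonAt k D h)) :
    toFrac k b ∈ Cq k D p h := by
  have hh := toFrac_mem_C_of_mem_epsilonInvariants k D hinv
  have hb' : epsilonAt k D h b = b := hb
  obtain ⟨u, hu⟩ := exists_aeval_rCr k D (incl k D b)
  have h1 := incl_epsilonAt k D h b
  rw [hb', ← hu, eval_epsilonTilde_aeval, incl_translation k D hh] at h1
  have : CharP (C k D) p := charP_of_injective_algebraMap (algebraMap k (C k D)).injective p
  have h2 : u.comp (Polynomial.X + Polynomial.C (translation k D hh)) = u := by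
    apply aeval_rCr_injective k D
    rw [Polynomial.aeval_comp, map_add, Polynomial.aeval_X, Polynomial.aeval_C, ← h1]
  obtain ⟨v, hv⟩ := exists_eq_comp_of_comp_X_add_C_eq p (translation_ne_zero k D hh h0) u h2
  have h3 : toFrac k b = Polynomial.aeval (toFrac k (q k D p h)) v := by
    rw [← aeval_artinSchreier k D p hh, ← Polynomial.aeval_comp, ← hv]
    have h4 := congrArg (Cr k D).val hu
    rw [← Polynomial.aeval_algHom_apply] at h4
    exact h4.symm
  rw [h3, Cq, Algebra.adjoin_singleton_eq_range_aeval]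
  exact ⟨v, rfl⟩

theorem epsilonAt_q {h : Poly k} (hinv : h ∈ epsilonInvariants k D) :
    epsilonAt k D h (q k D p h) = q k D p h := by
  have hh := epsilonAt_of_mem k D h (toFrac_mem_C_of_mem_epsilonInvariants k D hinv)
  have hf := epsilonAt_of_mem k D h (f_mem_C k D)
  have hg := epsilonAt_of_mem k D h (g_mem_C k D)
  have hp1 : p - 1 + 1 = p := Nat.sub_add_cancel hp.out.one_le
  simp only [q, map_sub, map_mul, map_pow, epsilonAt_r, hh, hf, hg]
  have h1 : (f k D ^ D.l * g k D * h) ^ p =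
      (f k D ^ D.l * g k D * h) ^ (p - 1) * (f k D ^ D.l * g k D * h) := by
    rw [← pow_succ, hp1]
  rw [add_pow_char, h1]
  ring

end RankThree

/-! ### The invariant ring equals k[ψ(x₁^p), ψ(x₂^p), ψ(x₃^p), f, g] -/

namespace RankThree

variable (k : Type*) [Field k] (D : Params)

/-- The homomorphism `k[x₁, x₂, x₃, y, z] → k[x₁, x₂, x₃]` with `xᵢ ↦ yᵢ`, `y ↦ f`, `z ↦ g`. -/
noncomputable def subHom (y : Fin 3 → Poly k) : MvPolynomial (Fin 5) k →ₐ[k] Poly k :=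
  MvPolynomial.aeval ![y 0, y 1, y 2, f k D, g k D]

theorem subHom_X_three (y : Fin 3 → Poly k) :
    subHom k D y (MvPolynomial.X 3) = f k D := by simp [subHom]

theorem subHom_X_four (y : Fin 3 → Poly k) :
    subHom k D y (MvPolynomial.X 4) = g k D := by simp [subHom]

variable (p : ℕ)

theorem dvd_subHom_sub_powHom {y : Fin 3 → Poly k} {a : Poly k}
    (hy : ∀ i, a ∣ y i - MvPolynomial.X i ^ p) (P : MvPolynomial (Fin 5) k) :
    a ∣ subHom k D y P - powHom k D p P := by
  induction P using MvPolynomial.induction_on with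
  | C c => simp [subHom, powHom]
  | add b c hb hc =>
    rw [map_add, map_add, add_sub_add_comm]
    exact dvd_add hb hc
  | mul_X b i hb =>
    have hX : a ∣ subHom k D y (MvPolynomial.X i) - powHom k D p (MvPolynomial.X i) := by
      fin_cases i <;> simp [subHom, powHom, hy]
    rw [map_mul, map_mul]
    rw [show subHom k D y b * subHom k D y (MvPolynomial.X i) -
      powHom k D p b * powHom k D p (MvPolynomial.X i) =
      (subHom k D y b - powHom k D p b) * subHom k D y (MvPolynomial.X i) +
      powHom k D p b * (subHom k D y (MvPolynomial.X i) - powHom k D p (MvPolynomial.X i)) by ring]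
    exact dvd_add (hb.mul_right _) (hX.mul_left _)

/-- Every element of `C[q]` becomes an element of `k[y₁, y₂, y₃, f, g]` after multiplication by a
power of `f g`. -/
theorem exists_pow_mul_eq_of_mem_Cq {h : Poly k} {y : Fin 3 → Poly k}
    (hy1 : (f k D ^ D.l) ^ p * y 1 + y 0 ^ D.m = q k D p h) {z : Frac k}
    (hz : z ∈ Cq k D p h) :
    ∃ (N : ℕ) (P : MvPolynomial (Fin 5) k),
      toFrac k (f k D * g k D) ^ N * z = toFrac k (subHom k D y P) := by
  have hfg : subHom k D y (MvPolynomial.X 3 * MvPolynomial.X 4) = f k D * g k D := by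
    rw [map_mul, subHom_X_three, subHom_X_four]
  -- The localization k[y₁, y₂, y₃, f, g][1/(f g)]. It contains f⁻¹ and g⁻¹, because f g f⁻¹ = g and
  -- f g g⁻¹ = f, and it contains q by `hy1`.
  let A : Subalgebra k (Frac k) :=
    { carrier := {z | ∃ (N : ℕ) (P : MvPolynomial (Fin 5) k),
        toFrac k (f k D * g k D) ^ N * z = toFrac k (subHom k D y P)}
      mul_mem' := by
        rintro a b ⟨N, P, hP⟩ ⟨M, Q, hQ⟩
        exact ⟨N + M, P * Q, by
          rw [map_mul (subHom k D y), map_mul _ (subHom k D y P), ← hP, ← hQ]; ring⟩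
      add_mem' := by
        rintro a b ⟨N, P, hP⟩ ⟨M, Q, hQ⟩
        refine ⟨N + M, (MvPolynomial.X 3 * MvPolynomial.X 4) ^ M * P +
          (MvPolynomial.X 3 * MvPolynomial.X 4) ^ N * Q, ?_⟩
        rw [map_add (subHom k D y), map_mul (subHom k D y), map_mul (subHom k D y),
          map_pow (subHom k D y), map_pow (subHom k D y), hfg, map_add, map_mul _ (_ ^ M),
          map_mul _ (_ ^ N), map_pow _ _ M, map_pow _ _ N, ← hP, ← hQ]
        ring
      algebraMap_mem' := fun c => ⟨0, MvPolynomial.C c, by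
        rw [pow_zero, one_mul]
        have h1 : subHom k D y (MvPolynomial.C c) = algebraMap k (Poly k) c :=
          (subHom k D y).commutes c
        rw [h1]
        exact ((toFrac k).commutes c).symm⟩ }
  have hf := tf_ne_zero k D
  have hg := tg_ne_zero k D
  have hC : C k D ≤ A := by
    rw [C, Algebra.adjoin_le_iff]
    rintro x (rfl | rfl | rfl | rfl)
    · exact ⟨0, MvPolynomial.X 3, by rw [subHom_X_three]; simp⟩
    · exact ⟨1, MvPolynomial.X 4, by rw [subHom_X_four, map_mul]; field_simp⟩
    · exact ⟨0, MvPolynomial.X 4, by rw [subHom_X_four]; simp⟩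
    · exact ⟨1, MvPolynomial.X 3, by rw [subHom_X_three, map_mul]; field_simp⟩
  suffices H : z ∈ A from H
  induction hz using Algebra.adjoin_induction with
  | mem x hx =>
    obtain rfl := hx
    refine ⟨0, (MvPolynomial.X 3 ^ D.l) ^ p * MvPolynomial.X 1 + MvPolynomial.X 0 ^ D.m, ?_⟩
    rw [pow_zero, one_mul, ← hy1, map_add (subHom k D y), map_mul (subHom k D y),
      map_pow (subHom k D y), map_pow (subHom k D y), map_pow (subHom k D y), subHom_X_three]
    simp [subHom]
  | algebraMap c => exact hC c.2
  | add a b _ _ ha hb => exact add_mem ha hb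
  | mul a b _ _ ha hb => exact mul_mem ha hb

variable [hp : Fact p.Prime] [CharP k p]

/-- The homomorphism `k[x₁, x₂, x₃, y, z] → C[r ^ p]` with `xᵢ ↦ xᵢ ^ p`, `y ↦ f`,
`z ↦ g`. -/
noncomputable def crpHom : MvPolynomial (Fin 5) k →ₐ[k] Crp k D p :=
  MvPolynomial.aeval ![xPow k D p 0, xPow k D p 1, xPow k D p 2, fCrp k D p, gCrp k D p]

theorem coe_crpHom (P : MvPolynomial (Fin 5) k) :
    (crpHom k D p P : Frac k) = toFrac k (powHom k D p P) := by
  have : ((Crp k D p).val.restrictScalars k).comp (crpHom k D p) =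
      (toFrac k).comp (powHom k D p) := by
    ext i : 1
    fin_cases i <;> simp [crpHom, powHom] <;> rfl
  exact DFunLike.congr_fun this P

variable {k D p} in
theorem psiFrac_crpHom {h : Poly k} {y : Fin 3 → Poly k}
    (hy : ∀ i, psiFrac k D p h (xPow k D p i) = toFrac k (y i)) (P : MvPolynomial (Fin 5) k) :
    psiFrac k D p h (crpHom k D p P) = toFrac k (subHom k D y P) := by
  have : (psiFrac k D p h).comp (crpHom k D p) = (toFrac k).comp (subHom k D y) := by
    ext i : 1
    fin_cases i <;> simp [crpHom, subHom, hy, psiFrac_fCrp, psiFrac_gCrp]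
  exact DFunLike.congr_fun this P

/-- `subHom` is `powHom` followed by ψ, which is injective. -/
theorem subHom_eq_zero_iff {h : Poly k} (hh : toFrac k h ∈ C k D) {y : Fin 3 → Poly k}
    (hy : ∀ i, psiFrac k D p h (xPow k D p i) = toFrac k (y i)) (P : MvPolynomial (Fin 5) k) :
    subHom k D y P = 0 ↔ powHom k D p P = 0 := by
  rw [← map_eq_zero_iff _ (toFrac_injective k), ← psiFrac_crpHom hy,
    map_eq_zero_iff _ (psiFrac_injective k D p hh), ← map_eq_zero_iff _ (toFrac_injective k),
    ← coe_crpHom]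
  exact (ZeroMemClass.coe_eq_zero).symm

theorem ker_subHom (hpt : ¬ p ∣ D.t) {h : Poly k} (hh : toFrac k h ∈ C k D) {y : Fin 3 → Poly k}
    (hy : ∀ i, psiFrac k D p h (xPow k D p i) = toFrac k (y i)) :
    RingHom.ker (subHom k D y) = relIdeal k D p := by
  rw [← ker_powHom k D p hpt]
  ext P
  exact subHom_eq_zero_iff k D p hh hy P

/-- Transfers division by `a` from k[x^p, f, g] to its image under ψ. The congruences carry the
divisibility over to `powHom`; the resulting factorization is a polynomial relation and comes back
because both homomorphisms have the same kernel. The variable `Z` stands for `a` on both sides. -/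
theorem exists_subHom_eq_mul {h : Poly k} (hh : toFrac k h ∈ C k D) {y : Fin 3 → Poly k}
    (hy : ∀ i, psiFrac k D p h (xPow k D p i) = toFrac k (y i)) {a : Poly k}
    (hya : ∀ i, a ∣ y i - MvPolynomial.X i ^ p) {Z : MvPolynomial (Fin 5) k}
    (hZ : powHom k D p Z = a) (hZ' : subHom k D y Z = a)
    (ha : ∀ P, a ∣ powHom k D p P → ∃ P', powHom k D p P = a * powHom k D p P')
    (P : MvPolynomial (Fin 5) k) (hP : a ∣ subHom k D y P) :
    ∃ P', subHom k D y P = a * subHom k D y P' := by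
  have h1 : a ∣ powHom k D p P := (dvd_sub_right hP).1 (dvd_subHom_sub_powHom k D p hya P)
  obtain ⟨P', hP'⟩ := ha P h1
  refine ⟨P', ?_⟩
  have h2 : powHom k D p (P - Z * P') = 0 := by rw [map_sub, map_mul, hZ, hP', sub_self]
  rw [← subHom_eq_zero_iff k D p hh hy, map_sub, map_mul, hZ', sub_eq_zero] at h2
  exact h2

/-- An invariant lies in C[q], so some (f g)^N times it lies in k[y₁, y₂, y₃, f, g], and the factors
f and g are stripped off one at a time. Conversely, f, g and q are invariant, and the relations
express the yᵢ through them. -/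
theorem invariants_eq_range {h : Poly k} (hpt : ¬ p ∣ D.t) (hpmt : ¬ p ∣ D.m * D.t - 1)
    (hinv : h ∈ epsilonInvariants k D) (h0 : h ≠ 0) {y : Fin 3 → Poly k}
    (hyd : ∀ i, f k D * g k D ∣ y i - MvPolynomial.X i ^ p)
    (hy0 : g k D ^ p * y 0 = (f k D ^ p) ^ (D.l * D.t + 1) + q k D p h ^ D.t)
    (hy1 : (f k D ^ D.l) ^ p * y 1 + y 0 ^ D.m = q k D p h)
    (hy2 : y 0 * y 2 = f k D ^ p + y 1 ^ D.t) (hy : y 0 ≠ 0) :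
    invariants k (epsilonAt k D h) = (subHom k D y).range := by
  have hh := toFrac_mem_C_of_mem_epsilonInvariants k D hinv
  have hpsi := psiFrac_xPow k D p h hy0 hy1 hy2 hy
  have hf := f_ne_zero k D
  have hg := g_ne_zero k D
  apply le_antisymm
  · intro b hb
    obtain ⟨N, P, hP⟩ := exists_pow_mul_eq_of_mem_Cq k D p hy1
      (toFrac_mem_Cq_of_mem_invariants k D p hinv h0 hb)
    rw [← map_pow, ← map_mul] at hP
    replace hP := toFrac_injective k hP
    have hF := exists_subHom_eq_mul k D p hh hpsi (fun i => (dvd_mul_right _ _).trans (hyd i))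
      (powHom_X_three k D p) (subHom_X_three k D y) (exists_powHom_eq_f_mul k D p hpmt)
    have hG := exists_subHom_eq_mul k D p hh hpsi (fun i => (dvd_mul_left _ _).trans (hyd i))
      (powHom_X_four k D p) (subHom_X_four k D y) (exists_powHom_eq_g_mul k D p hpt)
    induction N generalizing P with
    | zero => exact ⟨P, hP.symm.trans (by ring)⟩
    | succ N ih =>
      obtain ⟨P', hP'⟩ := hF P ⟨g k D * (f k D * g k D) ^ N * b, by rw [← hP]; ring⟩
      rw [hP'] at hP
      have h1 : g k D * ((f k D * g k D) ^ N * b) = subHom k D y P' :=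
        mul_left_cancel₀ hf (by rw [← hP]; ring)
      obtain ⟨P'', hP''⟩ := hG P' ⟨_, h1.symm⟩
      rw [hP''] at h1
      exact ih P'' (mul_left_cancel₀ hg h1)
  · have Ef := epsilonAt_of_mem k D h (f_mem_C k D)
    have Eg := epsilonAt_of_mem k D h (g_mem_C k D)
    have Eq := epsilonAt_q k D p hinv
    set φ := epsilonAt k D h
    have E0 : φ (y 0) = y 0 := by
      apply mul_left_cancel₀ (pow_ne_zero p hg)
      rw [hy0, ← Eq, ← Ef]
      have h1 := congrArg φ hy0
      simp only [map_add, map_mul, map_pow, Ef, Eg, Eq] at h1 ⊢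
      exact h1
    have E1 : φ (y 1) = y 1 := by
      have h1 := congrArg φ hy1
      simp only [map_add, map_mul, map_pow, Ef, Eq, E0] at h1
      rw [← hy1] at h1
      exact mul_left_cancel₀ (pow_ne_zero p (pow_ne_zero D.l hf)) (add_right_cancel h1)
    have E2 : φ (y 2) = y 2 := by
      have h1 := congrArg φ hy2
      simp only [map_add, map_mul, map_pow, Ef, E0, E1] at h1
      rw [← hy2] at h1
      exact mul_left_cancel₀ hy h1
    rintro _ ⟨P, rfl⟩
    have : φ.comp (subHom k D y) = subHom k D y := by
      ext i : 1
      fin_cases i <;> simp [subHom, E0, E1, E2, Ef, Eg]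
    exact DFunLike.congr_fun this P

end RankThree

/-! ### Tangent vectors at the origin -/

namespace RankThree

section General

variable {k σ τ : Type*} [Field k]

/-- The homomorphism to the dual numbers given by a tangent vector `c` at the origin. -/
noncomputable def tangentHom (c : σ → k) : MvPolynomial σ k →ₐ[k] DualNumber k :=
  MvPolynomial.aeval fun i => TrivSqZeroExt.inr (c i)

theorem fst_tangentHom (c : σ → k) (P : MvPolynomial σ k) :
    (tangentHom c P).fst = MvPolynomial.constantCoeff P := by
  induction P using MvPolynomial.induction_on with
  | C a => simp [tangentHom]; rfl
  | add a b ha hb => simp [ha, hb]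
  | mul_X a i ha => simp [tangentHom]

theorem snd_tangentHom_add (c c' : σ → k) (P : MvPolynomial σ k) :
    (tangentHom (c + c') P).snd = (tangentHom c P).snd + (tangentHom c' P).snd := by
  induction P using MvPolynomial.induction_on with
  | C a => simp [tangentHom]; rfl
  | add a b ha hb => simp only [map_add, TrivSqZeroExt.snd_add, ha, hb]; ring
  | mul_X a i ha =>
    simp only [map_mul, TrivSqZeroExt.snd_mul, fst_tangentHom]
    simp [tangentHom]
    ring

theorem snd_tangentHom_smul (b : k) (c : σ → k) (P : MvPolynomial σ k) :
    (tangentHom (b • c) P).snd = b * (tangentHom c P).snd := by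
  induction P using MvPolynomial.induction_on with
  | C a => simp only [tangentHom, MvPolynomial.aeval_C]; exact (mul_zero b).symm
  | add a b ha hb => simp only [map_add, TrivSqZeroExt.snd_add, ha, hb]; ring
  | mul_X a i ha =>
    simp only [map_mul, TrivSqZeroExt.snd_mul, fst_tangentHom]
    simp [tangentHom]
    ring

/-- If all tangent vectors of affine `σ`-space at the origin are tangent to the zero set of `I`,
then the coordinate ring is not a polynomial ring in fewer variables. -/
theorem isEmpty_algEquiv_of_tangentHom_eq_zero [Fintype σ] [Fintype τ]
    (hcard : Fintype.card τ < Fintype.card σ) (I : Ideal (MvPolynomial σ k))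
    (hI : ∀ c : σ → k, ∀ P ∈ I, tangentHom c P = 0) :
    IsEmpty ((MvPolynomial σ k ⧸ I) ≃ₐ[k] MvPolynomial τ k) := by
  refine ⟨fun e => ?_⟩
  choose P hP using fun j : τ => Ideal.Quotient.mk_surjective (e.symm (MvPolynomial.X j))
  -- A homomorphism from the polynomial ring in `τ` to the dual numbers is determined by its values
  -- on the variables. Their constant parts do not depend on `c`, and their infinitesimal parts are
  -- `L c`. A nonzero `c` in the kernel of `L` thus induces the same map as 0, although the two
  -- differ on the variables of `σ`.
  let L : (σ → k) →ₗ[k] (τ → k) :=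
    { toFun := fun c j => (tangentHom c (P j)).snd
      map_add' := fun c c' => funext fun j => snd_tangentHom_add c c' (P j)
      map_smul' := fun b c => funext fun j => snd_tangentHom_smul b c (P j) }
  obtain ⟨c, hc, hc0⟩ : ∃ c, L c = 0 ∧ c ≠ 0 := by
    have hker : LinearMap.ker L ≠ ⊥ := LinearMap.ker_ne_bot_of_finrank_lt (by simpa using hcard)
    obtain ⟨c, hc, hc0⟩ := Submodule.exists_mem_ne_zero_of_ne_bot hker
    exact ⟨c, hc, hc0⟩
  let T : (σ → k) → (MvPolynomial σ k ⧸ I) →ₐ[k] DualNumber k := fun c =>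
    Ideal.Quotient.liftₐ I (tangentHom c) (hI c)
  have hT : ∀ c P, T c (Ideal.Quotient.mk I P) = tangentHom c P := fun c P => rfl
  have h1 : (T c).comp e.symm.toAlgHom = (T 0).comp e.symm.toAlgHom := by
    ext j : 1
    change T c (e.symm (MvPolynomial.X j)) = T 0 (e.symm (MvPolynomial.X j))
    rw [← hP, hT, hT]
    apply TrivSqZeroExt.ext
    · rw [fst_tangentHom, fst_tangentHom]
    · have h2 : (tangentHom c (P j)).snd = 0 := congrFun hc j
      have h3 : (tangentHom (0 : σ → k) (P j)).snd = 0 := congrFun (map_zero L) j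
      rw [h2, h3]
  apply hc0
  ext i
  have h2 := DFunLike.congr_fun h1 (e (Ideal.Quotient.mk I (MvPolynomial.X i)))
  change T c (e.symm (e _)) = T 0 (e.symm (e _)) at h2
  rw [e.symm_apply_apply, hT, hT] at h2
  simpa [tangentHom] using congrArg TrivSqZeroExt.snd h2

end General

variable (k : Type*) [Field k] (D : Params)

theorem aeval_f_eq_zero {B : Type*} [CommRing B] [Algebra k B] (e : Fin 3 → B)
    (he : ∀ i j, e i * e j = 0) : MvPolynomial.aeval e (f k D) = 0 := by
  have h1 : e 1 ^ D.t = e 1 * e 1 * e 1 ^ (D.t - 2) := by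
    rw [mul_assoc, ← pow_succ', ← pow_succ']
    congr 1; have := D.two_le_t; omega
  simp [f, he, h1]

/-- Here f goes to 0 and r to `e 0 ^ m`, so only the term `i = t - 1` of the sum survives. The
result is `e 0 ^ (m * t - 1)`, with exponent at least 2 since `m * t ≥ 3`. -/
theorem aeval_g_eq_zero {B : Type*} [CommRing B] [Algebra k B] (e : Fin 3 → B)
    (he : ∀ i j, e i * e j = 0) : MvPolynomial.aeval e (g k D) = 0 := by
  have hl := D.one_le_l
  have hm := D.one_le_m
  have ht := D.two_le_t
  have hmt := D.three_le_mt
  have hf := aeval_f_eq_zero k D e he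
  rw [g]
  simp only [r, map_add, map_mul, map_pow, map_sum, hf, MvPolynomial.aeval_X]
  rw [zero_pow (by positivity), zero_pow (by omega)]
  simp only [zero_mul, zero_add]
  rw [Finset.sum_eq_single (D.t - 1)]
  · rw [Nat.sub_self, pow_zero, mul_one, ← pow_mul, ← pow_add]
    have h1 : D.m - 1 + D.m * (D.t - 1) = (D.m * D.t - 3) + 1 + 1 := by
      have : D.m * D.t = D.m * (D.t - 1) + D.m := by
        rw [← Nat.mul_succ]; congr 1; omega
      omega
    rw [h1, pow_succ, pow_succ, mul_assoc, he, mul_zero]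
  · intro i hi hne
    have := Finset.mem_range.1 hi
    rw [zero_pow (by omega), mul_zero]
  · intro h0
    exact absurd (Finset.mem_range.2 (by omega)) h0

/-- The variables go to elements with pairwise products 0, so y^p and z^p vanish because p ≥ 2, as
do f and g. Every one of the five directions is therefore tangent. -/
theorem tangentHom_eq_zero_of_mem_relIdeal (p : ℕ) [hp : Fact p.Prime] (c : Fin 5 → k)
    {P : MvPolynomial (Fin 5) k} (hP : P ∈ relIdeal k D p) : tangentHom c P = 0 := by
  have he : ∀ i j, tangentHom c (MvPolynomial.X i) * tangentHom c (MvPolynomial.X j) = 0 := by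
    intro i j
    simp [tangentHom]
  have hpow : ∀ i, tangentHom c (MvPolynomial.X i) ^ p = 0 := by
    intro i
    have h1 : p = p - 2 + 1 + 1 := by have := hp.out.two_le; omega
    rw [h1, pow_succ, pow_succ, mul_assoc, he, mul_zero]
  have hemb : ∀ s, tangentHom c (embed k s) =
      MvPolynomial.aeval (fun i => tangentHom c (MvPolynomial.X (Fin.castAdd 2 i))) s := by
    intro s
    rw [embed, tangentHom, MvPolynomial.aeval_rename]
    congr 2
    ext i : 1
    simp
  have : relIdeal k D p ≤ RingHom.ker (tangentHom c) := by
    rw [relIdeal_eq, Ideal.span_le]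
    rintro x (rfl | rfl)
    · rw [SetLike.mem_coe, RingHom.mem_ker, map_sub, map_pow, hpow, hemb,
        aeval_f_eq_zero k D _ (fun i j => he _ _), sub_zero]
    · rw [SetLike.mem_coe, RingHom.mem_ker, map_sub, map_pow, hpow, hemb,
        aeval_g_eq_zero k D _ (fun i j => he _ _), sub_zero]
  exact this hP

end RankThree

/-! ### The main theorem -/

theorem mainTheorem7 (k : Type*) [Field k] (p : ℕ) [Fact p.Prime] [CharP k p]
    (D : RankThree.Params) (hpt : ¬ p ∣ D.t) (hpmt : ¬ p ∣ D.m * D.t - 1)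
    (h : RankThree.Poly k) (hinv : h ∈ RankThree.epsilonInvariants k D)
    (hh : ∃ u ∈ Algebra.adjoin k {RankThree.f k D, RankThree.g k D},
      h ^ (p - 1) = RankThree.f k D ^ (D.l + 1) * RankThree.g k D ^ 2 * u)
    (hh0 : h ^ (p - 1) ≠ 0) :
    ((RankThree.invariants k (RankThree.epsilonAt k D h)).map (RankThree.toFrac k) =
        (Algebra.adjoin k {RankThree.xPow k D p 0, RankThree.xPow k D p 1,
          RankThree.xPow k D p 2, RankThree.fCrp k D p, RankThree.gCrp k D p}).map
            (RankThree.psiFrac k D p h) ∧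
      (RankThree.invariants k (RankThree.epsilonAt k D h)).map (RankThree.toFrac k) =
        Algebra.adjoin k {RankThree.psiFrac k D p h (RankThree.xPow k D p 0),
          RankThree.psiFrac k D p h (RankThree.xPow k D p 1),
          RankThree.psiFrac k D p h (RankThree.xPow k D p 2),
          RankThree.toFrac k (RankThree.f k D), RankThree.toFrac k (RankThree.g k D)}) ∧
    (Nonempty (RankThree.invariants k (RankThree.epsilonAt k D h) ≃ₐ[k]
        (MvPolynomial (Fin 5) k ⧸ RankThree.relIdeal k D p)) ∧
      ¬ Nonempty (RankThree.invariants k (RankThree.epsilonAt k D h) ≃ₐ[k]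
        MvPolynomial (Fin 3) k)) := by
  obtain ⟨u, -, hu⟩ := hh
  have hp := (Fact.out : p.Prime)
  have h0 : h ≠ 0 := by
    rintro rfl
    exact hh0 (zero_pow (Nat.sub_ne_zero_of_lt hp.one_lt))
  obtain ⟨y, hyd, hy0, hy1, hy2, hy⟩ := RankThree.exists_psi_X_pow k D p h hu
  have hrange := RankThree.invariants_eq_range k D p hpt hpmt hinv h0 hyd hy0 hy1 hy2 hy
  have hpsi := RankThree.psiFrac_xPow k D p h hy0 hy1 hy2 hy
  have hmap : (RankThree.invariants k (RankThree.epsilonAt k D h)).map (RankThree.toFrac k) =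
        Algebra.adjoin k {RankThree.psiFrac k D p h (RankThree.xPow k D p 0),
          RankThree.psiFrac k D p h (RankThree.xPow k D p 1),
          RankThree.psiFrac k D p h (RankThree.xPow k D p 2),
          RankThree.toFrac k (RankThree.f k D), RankThree.toFrac k (RankThree.g k D)} := by
    rw [hrange, RankThree.subHom, ← Algebra.adjoin_range_eq_range_aeval, AlgHom.map_adjoin,
      ← Set.range_comp]
    congr 1
    simp only [hpsi]
    ext x
    simp [Fin.exists_fin_succ, eq_comm]
  have hker := RankThree.ker_subHom k D p hpt
    (RankThree.toFrac_mem_C_of_mem_epsilonInvariants k D hinv) hpsi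
  have e : Nonempty (RankThree.invariants k (RankThree.epsilonAt k D h) ≃ₐ[k]
        (MvPolynomial (Fin 5) k ⧸ RankThree.relIdeal k D p)) := by
    rw [hrange, ← hker]
    exact ⟨(Ideal.quotientKerEquivRange _).symm⟩
  refine ⟨⟨?_, hmap⟩, e, ?_⟩
  · rw [hmap, AlgHom.map_adjoin]
    simp only [Set.image_insert_eq, Set.image_singleton, RankThree.psiFrac_fCrp,
      RankThree.psiFrac_gCrp]
  · rintro ⟨e'⟩
    obtain ⟨e⟩ := e
    exact (RankThree.isEmpty_algEquiv_of_tangentHom_eq_zero (σ := Fin 5) (τ := Fin 3) (by simp)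
      (RankThree.relIdeal k D p)
      (fun c P hP => RankThree.tangentHom_eq_zero_of_mem_relIdeal k D p c hP)).false
        (e.symm.trans e')
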